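/- Consider $n_1$ men and $n_2>n_1$ women. Each man has a strict preference order on the set of all women and each woman a strict preference order on the set of all men, all these $n_1+n_2$ orders being independent and uniformly random (equivalently, the instance is uniform among all instances). A stable matching is an injection $\mathcal M$ of the men into the women for which there is no unmatched pair $(m,w)$ such that $m$ prefers $w$ to $\mathcal M(m)$ and, if $w$ is matched in $\mathcal M$, $w$ prefers $m$ to her partner in $\mathcal M$. Let $S(\mathbf n)$, $\mathbf n=(n_1,n_2)$, be the number of stable matchings, and let $s(\mathbf n)=\log\frac{n_2}{n_2-n_1}$. If $n_2>n_1\to\infty$ (with no other restriction on $n_2$), then $$E[S(\mathbf n)]\sim \frac{n_1\exp\Bigl(-\frac{e^{s(\mathbf n)}-1-s(\mathbf n)}{e^{s(\mathbf n)}-1}\Bigr)}{(n_2-n_1)\,s(\mathbf n)} .$$ Consequently: (i) if $n_2/n_1\to1$, then $s(\mathbf n)\to\infty$ and $E[S(\mathbf n)]\sim e^{-1}\frac{n_1}{(n_2-n_1)\,s(\mathbf n)}$; in particular, if moreover $\frac{\log(n_2-n_1)}{\log n_1}\to0$ (for example, if $n_2-n_1$ is bounded), then $E[S(\mathbf n)]\sim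 e^{-1}\frac{n_1}{(n_2-n_1)\log n_1}$; (ii) if $n_2/n_1\to\infty$, then $E[S(\mathbf n)]\to1$; (iii) if $n_2/n_1\to c$ with $1<c<\infty$, then $E[S(\mathbf n)]\to e^{-1}\frac{\lambda(c)}{\log\lambda(c)}$, where $\lambda(c)=\bigl(\frac{c}{c-1}\bigr)^{c-1}$. -/

import Mathlib

open Filter Topology

namespace StableMatching

/-- An instance of the matching problem with `n₁` men and `n₂` women.
The first component gives, for each man `m`, a permutation whose value at a woman `w` is the
position (`0` is the best) of `w` on the list of `m`; the second component gives, for each woman,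
the positions of the men on her list. No ties are possible. -/
abbrev Instance (n₁ n₂ : ℕ) : Type :=
  (Fin n₁ → Equiv.Perm (Fin n₂)) × (Fin n₂ → Equiv.Perm (Fin n₁))

/-- Man `m` strictly prefers woman `w` to woman `w'`. -/
def ManPrefers {n₁ n₂ : ℕ} (P : Instance n₁ n₂) (m : Fin n₁) (w w' : Fin n₂) : Prop :=
  P.1 m w < P.1 m w'

/-- Woman `w` strictly prefers man `m` to man `m'`. -/
def WomanPrefers {n₁ n₂ : ℕ} (P : Instance n₁ n₂) (w : Fin n₂) (m m' : Fin n₁) : Prop :=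
  P.2 w m < P.2 w m'

/-- The pair `(m, w)` blocks the injection `M`: the two are not matched to each other, `m` prefers
`w` to his partner, and, if `w` is matched, then she prefers `m` to her partner. -/
def Blocks {n₁ n₂ : ℕ} (P : Instance n₁ n₂) (M : Fin n₁ ↪ Fin n₂) (m : Fin n₁) (w : Fin n₂) :
    Prop :=
  M m ≠ w ∧ ManPrefers P m w (M m) ∧ ∀ m' : Fin n₁, M m' = w → WomanPrefers P w m m'

/-- A matching (an injection of the men into the women) is stable if no pair blocks it. -/
def IsStable {n₁ n₂ : ℕ} (P : Instance n₁ n₂) (M : Fin n₁ ↪ Fin n₂) : Prop :=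
  ∀ (m : Fin n₁) (w : Fin n₂), ¬ Blocks P M m w

/-- The number of stable matchings of an instance. -/
noncomputable def numStable {n₁ n₂ : ℕ} (P : Instance n₁ n₂) : ℕ :=
  Nat.card {M : Fin n₁ ↪ Fin n₂ // IsStable P M}

/-- The expected number of stable matchings when the instance is chosen uniformly at random among
all instances, that is, when all preference permutations are uniform and independent. -/
noncomputable def expectedStable (n₁ n₂ : ℕ) : ℝ :=
  (∑ P : Instance n₁ n₂, (numStable P : ℝ)) / (Fintype.card (Instance n₁ n₂) : ℝ)

/-- The parameter `s = log (n₂ / (n₂ - n₁))`. -/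
noncomputable def sParam (n₁ n₂ : ℕ) : ℝ :=
  Real.log ((n₂ : ℝ) / ((n₂ : ℝ) - (n₁ : ℝ)))

/-- The function `λ(c) = (c / (c - 1)) ^ (c - 1)`, used for real `c > 1`. -/
noncomputable def lam (c : ℝ) : ℝ :=
  (c / (c - 1)) ^ (c - 1)

end StableMatching

namespace StableMatching

open MeasureTheory

/-! Write n, N for the numbers of men and women and d = N - n. The relative ranks in a uniform
permutation behave like independent uniform thresholds, so a fixed matching is stable with
probability equal to the integral over y in [0,1]ⁿ of ∏ₘ ∫₀¹ (1-x)^d ∏_{j≠m} (1 - x yⱼ) dx, and E[S]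
is this integral times N!/d! (`expectedStable_eq_integral`).

Put U = d + ∑ yⱼ. Each inner integral is 1/U times 1 + O(1/U), so the integrand is U⁻ⁿ times a
bounded factor `correction`, whose logarithm is ∑y/U - n(d + ∑y²)/U² up to O(n/U²)
(`correction_bounds`). Writing U⁻ⁿ as a Gamma integral in t and exchanging the integrals makes the
yⱼ independent truncated exponentials of rate t, while t acquires the weight e^{-dt}(1-e^{-t})ⁿ/t
(`integral_prod_manFactor`). Apart from the 1/t, this weight is a beta law in e^{-t}, concentrated
near s = log((d+n)/d).

For t near s the law of large numbers gives Us/n ≈ 1 and (d + ∑y²)s²/n ≈ 2 - 2g, with g = s/(e^s-1)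
= sd/n. The logarithm of `correction` is then close to 1 - g - (2-2g) = g - 1
(`abs_main_exponent_sub_le`). The exact constants combine to give E[S]·g ≈ e^{g-1}, which is the
claim.

Uniformity in N is the delicate point. It rests on d·s ≥ log(1+n) (`log_one_add_le_mul_log`), which
makes the relative variance of t about s of order 1/log n at worst. As a result, the error in
`abs_expectedStable_mul_bose_sub_le` depends on n only, and the three regimes are limits of g. -/

/-! ### Integral formula for the expected number of stable matchings. -/

/-- Among all permutations of `Fin N`, the proportion `1 / (#A + 1)` puts `v` last in `A ∪ {v}`. -/
theorem card_perm_forall_lt {N : ℕ} (A : Finset (Fin N)) (v : Fin N) (hv : v ∉ A) :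
    (A.card + 1) * (Finset.univ.filter
      fun σ : Equiv.Perm (Fin N) => ∀ w ∈ A, σ w < σ v).card = N.factorial := by
  classical
  -- The permutations are partitioned by which element of A ∪ {v} comes last; transposing u and v
  -- shows that all classes have the same size.
  have hcov : (Finset.univ : Finset (Equiv.Perm (Fin N))) =
      (insert v A).biUnion fun u => Finset.univ.filter
        fun σ : Equiv.Perm (Fin N) => ∀ w ∈ (insert v A).erase u, σ w < σ u := by
    ext σ
    simp only [Finset.mem_univ, Finset.mem_biUnion, Finset.mem_filter, true_and, true_iff]
    obtain ⟨u, hu, hmax⟩ := (insert v A).exists_max_image σ ⟨v, Finset.mem_insert_self v A⟩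
    refine ⟨u, hu, fun w hw => lt_of_le_of_ne (hmax w (Finset.mem_of_mem_erase hw)) ?_⟩
    exact fun h => Finset.ne_of_mem_erase hw (σ.injective h)
  have hcard : N.factorial = ∑ u ∈ insert v A, (Finset.univ.filter
      fun σ : Equiv.Perm (Fin N) => ∀ w ∈ (insert v A).erase u, σ w < σ u).card := by
    rw [← Finset.card_biUnion, ← hcov, Finset.card_univ, Fintype.card_perm, Fintype.card_fin]
    intro u hu u' hu' hne
    refine Finset.disjoint_left.2 fun σ h h' => ?_
    simp only [Finset.mem_filter, Finset.mem_univ, true_and] at h h'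
    exact lt_asymm (h u' (Finset.mem_erase.2 ⟨hne.symm, hu'⟩)) (h' u (Finset.mem_erase.2 ⟨hne, hu⟩))
  have heq : ∀ u ∈ insert v A, (Finset.univ.filter
      fun σ : Equiv.Perm (Fin N) => ∀ w ∈ (insert v A).erase u, σ w < σ u).card =
      (Finset.univ.filter fun σ : Equiv.Perm (Fin N) => ∀ w ∈ A, σ w < σ v).card := by
    intro u hu
    refine Finset.card_bij' (fun σ _ => σ * Equiv.swap u v) (fun σ _ => σ * Equiv.swap u v)
      ?_ ?_ (fun σ _ => by simp [mul_assoc]) (fun σ _ => by simp [mul_assoc])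
    · intro σ hσ
      simp only [Finset.mem_filter, Finset.mem_univ, true_and, Equiv.Perm.mul_apply,
        Equiv.swap_apply_right] at hσ ⊢
      intro w hw
      apply hσ
      have hwv : w ≠ v := fun h => hv (h ▸ hw)
      by_cases hwu : w = u
      · subst hwu
        simp [hwv.symm]
      · rw [Equiv.swap_apply_of_ne_of_ne hwu hwv]
        simp [hwu, hw]
    · intro σ hσ
      simp only [Finset.mem_filter, Finset.mem_univ, true_and, Equiv.Perm.mul_apply,
        Equiv.swap_apply_left] at hσ ⊢
      intro w hw
      obtain ⟨hwu, hw⟩ := Finset.mem_erase.1 hw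
      apply hσ
      by_cases hwv : w = v
      · subst hwv
        rw [Equiv.swap_apply_right]
        exact (Finset.mem_insert.1 hu).resolve_left (Ne.symm hwu)
      · rw [Equiv.swap_apply_of_ne_of_ne hwu hwv]
        exact (Finset.mem_insert.1 hw).resolve_left hwv
  rw [hcard, Finset.sum_congr rfl heq, Finset.sum_const, Finset.card_insert_of_notMem hv,
    smul_eq_mul]

/-- Averaging over a uniform permutation is the same as letting the position of `v` be a uniform
real number in `[0, 1]` and every other element independently precede `v`. -/
theorem sum_perm_prod_one_sub {N : ℕ} (v : Fin N) (y : Fin N → ℝ) :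
    ∑ σ : Equiv.Perm (Fin N), ∏ w ∈ Finset.univ.erase v,
        (1 - y w * if σ w < σ v then 1 else 0) =
      N.factorial * ∫ x in (0 : ℝ)..1, ∏ w ∈ Finset.univ.erase v, (1 - x * y w) := by
  classical
  -- After expansion over subsets, only the probability 1/(#A+1) that v follows all of A is needed,
  -- and this is ∫₀¹ x^#A dx.
  have key : ∀ A ∈ (Finset.univ.erase v).powerset,
      ∑ σ : Equiv.Perm (Fin N), ∏ w ∈ A, (if σ w < σ v then (1 : ℝ) else 0) =
        N.factorial * ∫ x in (0 : ℝ)..1, x ^ A.card := by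
    intro A hA
    have hv : v ∉ A := fun h => by simpa using Finset.mem_powerset.1 hA h
    have h := card_perm_forall_lt A v hv
    have h1 : ∀ σ : Equiv.Perm (Fin N), ∏ w ∈ A, (if σ w < σ v then (1 : ℝ) else 0) =
        if ∀ w ∈ A, σ w < σ v then 1 else 0 := fun σ => by
      rw [Finset.prod_ite_zero]; simp
    simp only [h1, Finset.sum_boole, integral_pow]
    rw [← h]
    push_cast
    field_simp
    simp
  have expand : ∀ c : Fin N → ℝ, ∏ w ∈ Finset.univ.erase v, (1 - c w) =
      ∑ A ∈ (Finset.univ.erase v).powerset, (-1) ^ A.card * ∏ w ∈ A, c w := fun c => by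
    simp only [sub_eq_add_neg, Finset.prod_one_add, Finset.prod_neg]
  simp only [expand, Finset.prod_mul_distrib, Finset.prod_const]
  rw [Finset.sum_comm, intervalIntegral.integral_finsetSum, Finset.mul_sum]
  · refine Finset.sum_congr rfl fun A hA => ?_
    simp only [← mul_assoc]
    rw [← Finset.mul_sum, key A hA, intervalIntegral.integral_mul_const,
      intervalIntegral.integral_const_mul]
    ring
  · intro A _
    apply Continuous.intervalIntegrable
    fun_prop

/-- The uniform distribution on `[0, 1]ⁿ`. -/
noncomputable abbrev cube (n : ℕ) : Measure (Fin n → ℝ) :=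
  Measure.pi fun _ => volume.restrict (Set.Ioc (0 : ℝ) 1)

/-- Splits a product over all women into matched and unmatched ones. -/
theorem prod_eq_prod_matched_mul {n N : ℕ} (M : Fin n ↪ Fin N) (f : Fin N → ℝ) :
    ∏ w, f w = (∏ i, f (M i)) * ∏ w ∈ (Finset.univ.map M)ᶜ, f w := by
  rw [← Finset.prod_mul_prod_compl (Finset.univ.map M) f, Finset.prod_map]

/-- The condition that m and w are not partners can be dropped: for w = M m the man's strict
inequality already fails. -/
theorem stable_indicator {n N : ℕ} (P : Instance n N) (M : Fin n ↪ Fin N) [Decidable (IsStable P M)] :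
    (if IsStable P M then (1 : ℝ) else 0) = ∏ w, ∏ m,
      (1 - (if P.1 m w < P.1 m (M m) then 1 else 0) *
        (if ∀ m', M m' = w → P.2 w m < P.2 w m' then 1 else 0)) := by
  classical
  have h : ∀ w m, (1 - (if P.1 m w < P.1 m (M m) then (1 : ℝ) else 0) *
        (if ∀ m', M m' = w → P.2 w m < P.2 w m' then 1 else 0)) =
        if ¬ Blocks P M m w then 1 else 0 := by
    intro w m
    have hb : Blocks P M m w ↔ P.1 m w < P.1 m (M m) ∧ ∀ m', M m' = w → P.2 w m < P.2 w m' :=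
      ⟨fun h => h.2, fun h => ⟨fun e => by simp [e] at h, h⟩⟩
    rw [hb]
    split_ifs <;> simp_all
  simp only [h, Finset.prod_ite_zero, Finset.prod_const_one, Finset.mem_univ, forall_true_left]
  refine if_congr ⟨fun h w m => h m w, fun h m w => h w m⟩ rfl rfl

theorem integral_cube_prod {n : ℕ} (f : Fin n → ℝ → ℝ) :
    ∫ y, ∏ i, f i (y i) ∂cube n = ∏ i, ∫ x in (0 : ℝ)..1, f i x := by
  rw [integral_fintype_prod_eq_prod]
  simp only [intervalIntegral.integral_of_le zero_le_one]

theorem cube_eq_restrict (n : ℕ) :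
    cube n = volume.restrict (Set.univ.pi fun _ => Set.Ioc (0 : ℝ) 1) := by
  rw [cube, volume_pi, Measure.restrict_pi_pi]

theorem integrable_cube_of_continuous {n : ℕ} {f : (Fin n → ℝ) → ℝ} (hf : Continuous f) :
    Integrable f (cube n) := by
  rw [cube_eq_restrict]
  exact (hf.continuousOn.integrableOn_compact
    (isCompact_univ_pi fun _ => isCompact_Icc (a := (0 : ℝ)) (b := 1))).mono_set
    (Set.pi_mono fun _ _ => Set.Ioc_subset_Icc_self)

/-- The probability, given that the thresholds of the women are `y`, that the `m`-th man is in no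
blocking pair, when there are `d` more women than men. -/
noncomputable def manFactor {n : ℕ} (d : ℕ) (y : Fin n → ℝ) (m : Fin n) : ℝ :=
  ∫ x in (0 : ℝ)..1, (1 - x) ^ d * ∏ j ∈ Finset.univ.erase m, (1 - x * y j)

/-- The two sides are averaged in turn. With the men's orders fixed the women are independent, and
each matched woman yields a uniform threshold. With the thresholds fixed the men are independent,
and each yields a uniform variable x. -/
theorem sum_stable_indicator {n N : ℕ} (M : Fin n ↪ Fin N)
    [∀ P : Instance n N, Decidable (IsStable P M)] :
    ∑ P : Instance n N, (if IsStable P M then (1 : ℝ) else 0) =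
      (N.factorial : ℝ) ^ n * (n.factorial : ℝ) ^ N *
        ∫ y, ∏ m, manFactor (N - n) y m ∂cube n := by
  classical
  let p : (Fin n → Equiv.Perm (Fin N)) → Fin n → Fin N → ℝ := fun σ m w =>
    if σ m w < σ m (M m) then 1 else 0
  -- A man's own partner contributes a factor 1, so she may be included in or erased from any
  -- product.
  have hp : ∀ σ m, p σ m (M m) = 0 := fun σ m => by simp [p]
  -- The default value 1 in `Function.extend M y 1` is the threshold of an unmatched woman, who
  -- accepts every man; these women later produce (1-x)^(N-n).
  have women : ∀ σ : Fin n → Equiv.Perm (Fin N), ∑ τ : Fin N → Equiv.Perm (Fin n), ∏ w, ∏ m,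
      (1 - p σ m w * (if ∀ m', M m' = w → τ w m < τ w m' then 1 else 0)) =
      (n.factorial : ℝ) ^ N * ∫ y, ∏ m, ∏ w ∈ Finset.univ.erase (M m),
        (1 - Function.extend M y 1 w * p σ m w) ∂cube n := by
    intro σ
    have swap : ∑ τ : Fin N → Equiv.Perm (Fin n), ∏ w, ∏ m,
        (1 - p σ m w * (if ∀ m', M m' = w → τ w m < τ w m' then 1 else 0)) =
        ∏ w, ∑ τ : Equiv.Perm (Fin n), ∏ m,
          (1 - p σ m w * (if ∀ m', M m' = w → τ m < τ m' then (1 : ℝ) else 0)) := by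
      rw [Finset.prod_univ_sum, Fintype.piFinset_univ]
    have matched : ∀ i, ∑ τ : Equiv.Perm (Fin n), ∏ m,
        (1 - p σ m (M i) * (if ∀ m', M m' = M i → τ m < τ m' then (1 : ℝ) else 0)) =
        n.factorial * ∫ y in (0 : ℝ)..1, ∏ m, (1 - y * p σ m (M i)) := by
      intro i
      have := sum_perm_prod_one_sub i fun m => p σ m (M i)
      simp only [M.injective.eq_iff, forall_eq]
      rw [Finset.sum_congr rfl fun τ _ => Finset.prod_erase _ (by simp [hp])] at this
      rw [this]
      congr 2 with x
      exact Finset.prod_erase _ (by simp [hp])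
    have unmatched : ∀ w ∈ (Finset.univ.map M)ᶜ, ∑ τ : Equiv.Perm (Fin n), ∏ m,
        (1 - p σ m w * (if ∀ m', M m' = w → τ m < τ m' then (1 : ℝ) else 0)) =
        n.factorial * ∏ m, (1 - p σ m w) := by
      intro w hw
      have hw' : ∀ i, M i ≠ w := by simpa using hw
      simp [hw', Fintype.card_perm]
    rw [swap, prod_eq_prod_matched_mul M, Finset.prod_congr rfl unmatched,
      Finset.prod_congr rfl fun i _ => matched i, Finset.prod_mul_distrib,
      Finset.prod_mul_distrib, Finset.prod_const, Finset.prod_const, mul_mul_mul_comm, ← pow_add,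
      Finset.card_compl, Finset.card_map, Finset.card_univ, Fintype.card_fin, Fintype.card_fin,
      Nat.add_sub_cancel' (by simpa using Fintype.card_le_of_embedding M),
      ← integral_cube_prod fun i y => ∏ m, (1 - y * p σ m (M i)), ← integral_mul_const]
    congr 2 with y
    rw [Finset.prod_congr rfl fun m _ => Finset.prod_erase _ (by simp [hp]),
      Finset.prod_comm (f := fun m w => 1 - Function.extend M y 1 w * p σ m w),
      prod_eq_prod_matched_mul M fun w => ∏ m, (1 - Function.extend M y 1 w * p σ m w)]
    congr 1
    · exact Finset.prod_congr rfl fun i _ => by rw [M.injective.extend_apply]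
    · refine Finset.prod_congr rfl fun w hw => ?_
      rw [Function.extend_apply' _ _ _ (by simpa using hw)]
      simp
  have men : ∀ y : Fin n → ℝ, ∑ σ : Fin n → Equiv.Perm (Fin N), ∏ m,
      ∏ w ∈ Finset.univ.erase (M m), (1 - Function.extend M y 1 w * p σ m w) =
      (N.factorial : ℝ) ^ n * ∏ m, manFactor (N - n) y m := by
    intro y
    have swap : ∑ σ : Fin n → Equiv.Perm (Fin N), ∏ m,
        ∏ w ∈ Finset.univ.erase (M m), (1 - Function.extend M y 1 w * p σ m w) =
        ∏ m, ∑ σ : Equiv.Perm (Fin N), ∏ w ∈ Finset.univ.erase (M m),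
          (1 - Function.extend M y 1 w * if σ w < σ (M m) then 1 else 0) := by
      rw [Finset.prod_univ_sum, Fintype.piFinset_univ]
    rw [swap, Finset.prod_congr rfl fun m _ => sum_perm_prod_one_sub (M m) _,
      Finset.prod_mul_distrib, Finset.prod_const, Finset.card_univ, Fintype.card_fin]
    congr 2 with m
    rw [manFactor]
    congr 1 with x
    have hs : (Finset.univ.erase (M m) : Finset (Fin N)) =
        (Finset.univ.erase m).map M ∪ (Finset.univ.map M)ᶜ := by
      ext w
      by_cases h : ∃ i, M i = w
      · obtain ⟨i, rfl⟩ := h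
        simp
      · have h1 : w ≠ M m := fun e => h ⟨m, e.symm⟩
        push Not at h
        simp [h, h1]
    rw [hs, Finset.prod_union, Finset.prod_map, mul_comm]
    · congr 1
      · rw [Finset.prod_congr rfl (g := fun _ => 1 - x), Finset.prod_const, Finset.card_compl,
          Finset.card_map]
        · simp
        · intro w hw
          rw [Function.extend_apply' _ _ _ (by simpa using hw)]
          simp
      · exact Finset.prod_congr rfl fun i _ => by rw [M.injective.extend_apply]
    · refine Finset.disjoint_left.2 fun w h h' => ?_
      simp only [Finset.mem_map, Finset.mem_compl, Finset.mem_univ, true_and] at h h'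
      obtain ⟨i, -, hi⟩ := h
      exact h' ⟨i, hi⟩
  simp only [stable_indicator]
  rw [Fintype.sum_prod_type, Finset.sum_congr rfl fun σ _ => women σ, ← Finset.mul_sum,
    ← integral_finsetSum]
  · simp only [men, integral_const_mul]
    ring
  · intro σ _
    refine integrable_cube_of_continuous ?_
    have : ∀ w, Continuous fun y : Fin n → ℝ => Function.extend M y 1 w := by
      intro w
      by_cases h : ∃ i, M i = w
      · obtain ⟨i, rfl⟩ := h
        simp only [M.injective.extend_apply]
        fun_prop
      · simp only [Function.extend_apply' _ _ _ h]
        fun_prop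
    fun_prop

theorem expectedStable_eq_integral {n N : ℕ} :
    expectedStable n N =
      N.descFactorial n * ∫ y, ∏ m, manFactor (N - n) y m ∂cube n := by
  classical
  have h1 : ∀ P : Instance n N, (numStable P : ℝ) =
      ∑ M : Fin n ↪ Fin N, if IsStable P M then (1 : ℝ) else 0 := by
    intro P
    rw [numStable, Nat.card_eq_fintype_card, Fintype.card_subtype, Finset.sum_boole]
  rw [expectedStable, Finset.sum_congr rfl fun P _ => h1 P, Finset.sum_comm,
    Finset.sum_congr rfl fun M _ => sum_stable_indicator M, Finset.sum_const, Finset.card_univ,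
    Fintype.card_embedding_eq, Fintype.card_fin, Fintype.card_fin]
  have h2 : (Fintype.card (Instance n N) : ℝ) = (N.factorial : ℝ) ^ n * (n.factorial : ℝ) ^ N := by
    simp [Instance, Fintype.card_perm]
  have h3 : (N.factorial : ℝ) ^ n * (n.factorial : ℝ) ^ N ≠ 0 := by positivity
  rw [h2, nsmul_eq_mul, div_eq_iff h3]
  ring

/-! ### Two-sided Laplace estimates for one man's factor. -/

theorem integrableOn_pow_mul_exp_neg_mul (k : ℕ) {a : ℝ} (ha : 0 < a) :
    IntegrableOn (fun x : ℝ => x ^ k * Real.exp (-(a * x))) (Set.Ioi 0) := by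
  have h := integrableOn_rpow_mul_exp_neg_mul_rpow (s := k) (p := 1) (b := a)
    (by have := k.cast_nonneg (α := ℝ); linarith) one_pos ha
  simpa [Real.rpow_natCast] using h

theorem integral_pow_mul_exp_neg_mul (k : ℕ) {a : ℝ} (ha : 0 < a) :
    ∫ x in Set.Ioi (0 : ℝ), x ^ k * Real.exp (-(a * x)) = k.factorial / a ^ (k + 1) := by
  have h := Real.integral_rpow_mul_exp_neg_mul_Ioi (a := k + 1) (r := a) (by positivity) ha
  rw [Real.Gamma_nat_eq_factorial] at h
  simp only [add_sub_cancel_right, Real.rpow_natCast] at h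
  rw [h]
  have : ((1 : ℝ) / a) ^ ((k : ℝ) + 1) = (1 / a) ^ (k + 1) := by
    exact_mod_cast Real.rpow_natCast (1 / a) (k + 1)
  rw [this, one_div, inv_pow]
  field_simp

/-- The first two terms of the series of -log(1-z), all of whose terms are nonnegative. -/
theorem one_sub_le_exp_neg_sub_sq {z : ℝ} (h0 : 0 ≤ z) (h1 : z ≤ 1) :
    1 - z ≤ Real.exp (-(z + z ^ 2 / 2)) := by
  rcases h1.eq_or_lt with rfl | h1
  · simpa using (Real.exp_pos _).le
  · have hs := Real.hasSum_pow_div_log_of_abs_lt_one (by rwa [abs_of_nonneg h0] : |z| < 1)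
    have := sum_le_hasSum (Finset.range 2) (fun i _ => by positivity) hs
    rw [← Real.log_le_iff_le_exp (by linarith)]
    norm_num [Finset.sum_range_succ] at this
    linarith

/-- Follows from (1-z)(1+z+z²/2) = 1 - z²/2 - z³/2 and the quadratic lower bound for e^z. -/
theorem exp_neg_mul_le_one_sub {z : ℝ} (h0 : 0 ≤ z) (h1 : z ≤ 1) :
    Real.exp (-z) * (1 - (z ^ 2 / 2 + z ^ 3 / 2)) ≤ 1 - z := by
  have h := mul_le_mul_of_nonneg_left (Real.quadratic_le_exp_of_nonneg h0) (by linarith : 0 ≤ 1 - z)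
  calc _ = Real.exp (-z) * ((1 - z) * (1 + z + z ^ 2 / 2)) := by ring
    _ ≤ Real.exp (-z) * ((1 - z) * Real.exp z) := by gcongr
    _ = 1 - z := by rw [mul_comm, mul_assoc, ← Real.exp_add]; simp

/-- Because (1-w+w²/2)(1+w+w²/2) = 1 + w⁴/4 ≥ 1. -/
theorem exp_neg_le_quadratic {w : ℝ} (hw : 0 ≤ w) : Real.exp (-w) ≤ 1 - w + w ^ 2 / 2 := by
  have h := Real.quadratic_le_exp_of_nonneg hw
  have hp : 0 < 1 + w + w ^ 2 / 2 := by positivity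
  rw [Real.exp_neg]
  refine (inv_anti₀ hp h).trans ?_
  rw [inv_le_iff_one_le_mul₀ hp]
  nlinarith [sq_nonneg (w ^ 2)]

theorem one_sub_sum_le_prod_one_sub {ι : Type*} (s : Finset ι) (c : ι → ℝ)
    (h0 : ∀ i ∈ s, 0 ≤ c i) (h1 : ∀ i ∈ s, c i ≤ 1) :
    1 - ∑ i ∈ s, c i ≤ ∏ i ∈ s, (1 - c i) := by
  classical
  induction s using Finset.induction_on with
  | empty => simp
  | insert a s ha ih =>
    rw [Finset.sum_insert ha, Finset.prod_insert ha]
    have hs := ih (fun i hi => h0 i (Finset.mem_insert_of_mem hi))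
      (fun i hi => h1 i (Finset.mem_insert_of_mem hi))
    have ha0 := h0 a (Finset.mem_insert_self a s)
    have ha1 := h1 a (Finset.mem_insert_self a s)
    have hsum : 0 ≤ ∑ i ∈ s, c i :=
      Finset.sum_nonneg fun i hi => h0 i (Finset.mem_insert_of_mem hi)
    nlinarith

section factor

variable {ι : Type*} (d : ℕ) (s : Finset ι) (y : ι → ℝ)

theorem pow_mul_prod_le_exp_neg (h0 : ∀ i ∈ s, 0 ≤ y i) (h1 : ∀ i ∈ s, y i ≤ 1) {x : ℝ}
    (hx0 : 0 ≤ x) (hx1 : x ≤ 1) :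
    (1 - x) ^ d * ∏ j ∈ s, (1 - x * y j) ≤ Real.exp (-((d + ∑ j ∈ s, y j) * x)) *
      Real.exp (-((d + ∑ j ∈ s, y j ^ 2) * x ^ 2 / 2)) := by
  have ha : (1 - x) ^ d ≤ Real.exp (-(x + x ^ 2 / 2)) ^ d :=
    pow_le_pow_left₀ (by linarith) (one_sub_le_exp_neg_sub_sq hx0 hx1) d
  have hxy : ∀ j ∈ s, x * y j ≤ 1 := fun j hj => mul_le_one₀ hx1 (h0 j hj) (h1 j hj)
  have hb : ∏ j ∈ s, (1 - x * y j) ≤ ∏ j ∈ s, Real.exp (-(x * y j + (x * y j) ^ 2 / 2)) :=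
    Finset.prod_le_prod (fun j hj => by have := hxy j hj; linarith)
      fun j hj => one_sub_le_exp_neg_sub_sq (mul_nonneg hx0 (h0 j hj)) (hxy j hj)
  have hn : 0 ≤ ∏ j ∈ s, (1 - x * y j) :=
    Finset.prod_nonneg fun j hj => by have := hxy j hj; linarith
  refine (mul_le_mul ha hb hn (by positivity)).trans (le_of_eq ?_)
  rw [← Real.exp_nat_mul, ← Real.exp_sum, ← Real.exp_add, ← Real.exp_add]
  congr 1
  rw [Finset.sum_neg_distrib, Finset.sum_add_distrib, ← Finset.sum_div, ← Finset.mul_sum]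
  simp only [mul_pow, ← Finset.mul_sum]
  ring

/-- After the exponential is extracted factor by factor, the remaining product of terms 1 - c is
bounded below by Bernoulli and its version for unequal factors. The bound y³ ≤ y lets the cubic
error be measured by the same sum as the linear term. -/
theorem exp_neg_mul_le_pow_mul_prod (h0 : ∀ i ∈ s, 0 ≤ y i) (h1 : ∀ i ∈ s, y i ≤ 1) {x : ℝ}
    (hx0 : 0 ≤ x) (hx1 : x ≤ 1) :
    Real.exp (-((d + ∑ j ∈ s, y j) * x)) * (1 - (d + ∑ j ∈ s, y j ^ 2) * x ^ 2 / 2 -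
      (d + ∑ j ∈ s, y j) * x ^ 3 / 2) ≤ (1 - x) ^ d * ∏ j ∈ s, (1 - x * y j) := by
  have hc : ∀ z : ℝ, 0 ≤ z → z ≤ 1 → z ^ 2 / 2 + z ^ 3 / 2 ≤ 1 := fun z hz hz1 => by
    have := pow_le_one₀ (n := 2) hz hz1
    have := pow_le_one₀ (n := 3) hz hz1
    linarith
  have hxy0 : ∀ j ∈ s, 0 ≤ x * y j := fun j hj => mul_nonneg hx0 (h0 j hj)
  have hxy : ∀ j ∈ s, x * y j ≤ 1 := fun j hj => mul_le_one₀ hx1 (h0 j hj) (h1 j hj)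
  set c : ι → ℝ := fun j => (x * y j) ^ 2 / 2 + (x * y j) ^ 3 / 2 with hcdef
  have hc0 : ∀ j ∈ s, 0 ≤ c j := fun j hj => by have := hxy0 j hj; positivity
  have hc1 : ∀ j ∈ s, c j ≤ 1 := fun j hj => hc _ (hxy0 j hj) (hxy j hj)
  set p := x ^ 2 / 2 + x ^ 3 / 2 with hp
  have hp0 : 0 ≤ p := by positivity
  have hp1 : p ≤ 1 := hc x hx0 hx1
  have hP : 1 - d * p ≤ (1 - p) ^ d := by
    have := one_add_mul_le_pow (a := -p) (by linarith) d
    simpa [sub_eq_add_neg] using this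
  have hP1 : (1 - p) ^ d ≤ 1 := pow_le_one₀ (by linarith) (by linarith)
  have hQ := one_sub_sum_le_prod_one_sub s c hc0 hc1
  have hQ1 : ∏ j ∈ s, (1 - c j) ≤ 1 := Finset.prod_le_one
    (fun j hj => by have := hc1 j hj; linarith) fun j hj => by have := hc0 j hj; linarith
  have hPQ : 1 - d * p - ∑ j ∈ s, c j ≤ (1 - p) ^ d * ∏ j ∈ s, (1 - c j) := by nlinarith
  have hsum : d * p + ∑ j ∈ s, c j ≤
      (d + ∑ j ∈ s, y j ^ 2) * x ^ 2 / 2 + (d + ∑ j ∈ s, y j) * x ^ 3 / 2 := by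
    have : ∑ j ∈ s, c j ≤ (∑ j ∈ s, y j ^ 2) * (x ^ 2 / 2) + (∑ j ∈ s, y j) * (x ^ 3 / 2) := by
      rw [Finset.sum_mul, Finset.sum_mul, ← Finset.sum_add_distrib]
      refine Finset.sum_le_sum fun j hj => ?_
      have h3 : y j ^ 3 ≤ y j := by
        have := mul_le_mul_of_nonneg_left (pow_le_one₀ (n := 2) (h0 j hj) (h1 j hj)) (h0 j hj)
        linarith [pow_succ' (y j) 2]
      have := mul_le_mul_of_nonneg_right h3 (by positivity : 0 ≤ x ^ 3 / 2)
      simp only [hcdef, mul_pow]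
      linarith
    rw [hp]
    linarith
  have hfac : Real.exp (-((d + ∑ j ∈ s, y j) * x)) * ((1 - p) ^ d * ∏ j ∈ s, (1 - c j)) ≤
      (1 - x) ^ d * ∏ j ∈ s, (1 - x * y j) := by
    have e : Real.exp (-((d + ∑ j ∈ s, y j) * x)) =
        Real.exp (-x) ^ d * ∏ j ∈ s, Real.exp (-(x * y j)) := by
      rw [← Real.exp_nat_mul, ← Real.exp_sum, ← Real.exp_add, Finset.sum_neg_distrib,
        ← Finset.mul_sum]
      congr 1
      ring
    rw [e, mul_mul_mul_comm, ← mul_pow, ← Finset.prod_mul_distrib]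
    refine mul_le_mul (pow_le_pow_left₀ ?_ (exp_neg_mul_le_one_sub hx0 hx1) d)
      (Finset.prod_le_prod (fun j hj => ?_)
        fun j hj => exp_neg_mul_le_one_sub (hxy0 j hj) (hxy j hj))
      (Finset.prod_nonneg fun j hj => ?_) (pow_nonneg (by linarith) d)
    · exact mul_nonneg (Real.exp_pos _).le (by linarith)
    all_goals exact mul_nonneg (Real.exp_pos _).le (by have := hc1 j hj; linarith)
  refine le_trans ?_ hfac
  gcongr
  linarith

/-- The quadratic-exponential factor is replaced by its Taylor majorant, which is positive and so
may be integrated over all of (0,∞). The Gamma moments give (b/2)·2!/a³ = b/a³ and (b²/8)·4!/a⁵ =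
3b²/a⁵. -/
theorem integral_pow_mul_prod_le (h0 : ∀ i ∈ s, 0 ≤ y i) (h1 : ∀ i ∈ s, y i ≤ 1) {a b : ℝ}
    (ha : a = d + ∑ j ∈ s, y j) (hb : b = d + ∑ j ∈ s, y j ^ 2) (hpos : 0 < a) :
    ∫ x in (0 : ℝ)..1, (1 - x) ^ d * ∏ j ∈ s, (1 - x * y j) ≤
      1 / a * (1 - b / a ^ 2 + 3 * (b / a ^ 2) ^ 2) := by
  have hb0 : 0 ≤ b := hb ▸ by positivity
  have i0 := integrableOn_pow_mul_exp_neg_mul 0 hpos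
  have i2 := integrableOn_pow_mul_exp_neg_mul 2 hpos
  have i4 := integrableOn_pow_mul_exp_neg_mul 4 hpos
  have i02 : IntegrableOn (fun x : ℝ => x ^ 0 * Real.exp (-(a * x)) -
      b / 2 * (x ^ 2 * Real.exp (-(a * x)))) (Set.Ioi 0) := i0.sub (i2.const_mul _)
  set F : ℝ → ℝ := fun x => x ^ 0 * Real.exp (-(a * x)) - b / 2 * (x ^ 2 * Real.exp (-(a * x))) +
    b ^ 2 / 8 * (x ^ 4 * Real.exp (-(a * x))) with hF
  have iF : IntegrableOn F (Set.Ioi 0) := i02.add (i4.const_mul _)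
  have hFx : ∀ x, F x = Real.exp (-(a * x)) *
      (1 - b * x ^ 2 / 2 + (b * x ^ 2 / 2) ^ 2 / 2) := fun x => by simp only [hF]; ring
  have intF : ∫ x in Set.Ioi (0 : ℝ), F x = 1 / a * (1 - b / a ^ 2 + 3 * (b / a ^ 2) ^ 2) := by
    simp only [hF]
    rw [integral_add i02 (i4.const_mul _), integral_sub i0 (i2.const_mul _),
      integral_const_mul, integral_const_mul, integral_pow_mul_exp_neg_mul 0 hpos,
      integral_pow_mul_exp_neg_mul 2 hpos, integral_pow_mul_exp_neg_mul 4 hpos]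
    norm_num [Nat.factorial]
    field_simp
    ring
  rw [← intF, intervalIntegral.integral_of_le zero_le_one]
  refine (setIntegral_mono_on ?_ (iF.mono_set Set.Ioc_subset_Ioi_self) measurableSet_Ioc
    fun x hx => ?_).trans (setIntegral_mono_set iF ?_
      (Eventually.of_forall Set.Ioc_subset_Ioi_self))
  · exact ((by fun_prop : Continuous fun x : ℝ =>
      (1 - x) ^ d * ∏ j ∈ s, (1 - x * y j)).integrableOn_Icc).mono_set Set.Ioc_subset_Icc_self
  · rw [hFx]
    refine (pow_mul_prod_le_exp_neg d s y h0 h1 hx.1.le hx.2).trans ?_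
    rw [← ha, ← hb]
    gcongr
    exact exp_neg_le_quadratic (by positivity)
  · filter_upwards with x
    rw [hFx]
    exact mul_nonneg (Real.exp_pos _).le (by nlinarith [sq_nonneg (b * x ^ 2 / 2 - 1)])

theorem integral_pow_mul_prod_le_inv (h0 : ∀ i ∈ s, 0 ≤ y i) (h1 : ∀ i ∈ s, y i ≤ 1) {a : ℝ}
    (ha : a = d + ∑ j ∈ s, y j) (hpos : 0 < a) :
    ∫ x in (0 : ℝ)..1, (1 - x) ^ d * ∏ j ∈ s, (1 - x * y j) ≤ 1 / a := by
  have i0 := integrableOn_pow_mul_exp_neg_mul 0 hpos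
  have e := integral_pow_mul_exp_neg_mul 0 hpos
  simp only [pow_zero, one_mul, Nat.factorial_zero, Nat.cast_one, zero_add, pow_one] at i0 e
  rw [← e, intervalIntegral.integral_of_le zero_le_one]
  refine (setIntegral_mono_on ?_ (i0.mono_set Set.Ioc_subset_Ioi_self) measurableSet_Ioc
    fun x hx => ?_).trans (setIntegral_mono_set i0 ?_
      (Eventually.of_forall Set.Ioc_subset_Ioi_self))
  · exact ((by fun_prop : Continuous fun x : ℝ =>
      (1 - x) ^ d * ∏ j ∈ s, (1 - x * y j)).integrableOn_Icc).mono_set Set.Ioc_subset_Icc_self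
  · refine (pow_mul_prod_le_exp_neg d s y h0 h1 hx.1.le hx.2).trans ?_
    rw [← ha]
    refine mul_le_of_le_one_right (Real.exp_pos _).le ?_
    rw [Real.exp_le_one_iff]
    have : 0 ≤ ((d : ℝ) + ∑ j ∈ s, y j ^ 2) * x ^ 2 / 2 := by positivity
    linarith
  · filter_upwards with x
    exact (Real.exp_pos _).le

/-- The 5 is 3 + 2: the cubic term gives (a/2)·3!/a⁴ = 3/a³, and the part of the Gamma integrals
beyond x = 1 costs at most e^{-a}/a ≤ 2/a³. -/
theorem le_integral_pow_mul_prod (h0 : ∀ i ∈ s, 0 ≤ y i) (h1 : ∀ i ∈ s, y i ≤ 1) {a b : ℝ}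
    (ha : a = d + ∑ j ∈ s, y j) (hb : b = d + ∑ j ∈ s, y j ^ 2) (hpos : 0 < a) :
    1 / a * (1 - b / a ^ 2 - 5 / a ^ 2) ≤
      ∫ x in (0 : ℝ)..1, (1 - x) ^ d * ∏ j ∈ s, (1 - x * y j) := by
  have hb0 : 0 ≤ b := hb ▸ by positivity
  have i0 := integrableOn_pow_mul_exp_neg_mul 0 hpos
  have i2 := integrableOn_pow_mul_exp_neg_mul 2 hpos
  have i3 := integrableOn_pow_mul_exp_neg_mul 3 hpos
  have i02 : IntegrableOn (fun x : ℝ => x ^ 0 * Real.exp (-(a * x)) -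
      b / 2 * (x ^ 2 * Real.exp (-(a * x)))) (Set.Ioi 0) := i0.sub (i2.const_mul _)
  set F : ℝ → ℝ := fun x => x ^ 0 * Real.exp (-(a * x)) - b / 2 * (x ^ 2 * Real.exp (-(a * x))) -
    a / 2 * (x ^ 3 * Real.exp (-(a * x))) with hF
  have iF : IntegrableOn F (Set.Ioi 0) := i02.sub (i3.const_mul _)
  have hFx : ∀ x, F x = Real.exp (-(a * x)) *
      (1 - b * x ^ 2 / 2 - a * x ^ 3 / 2) := fun x => by simp only [hF]; ring
  have intF : ∫ x in Set.Ioi (0 : ℝ), F x = 1 / a * (1 - b / a ^ 2 - 3 / a ^ 2) := by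
    simp only [hF]
    rw [integral_sub i02 (i3.const_mul _), integral_sub i0 (i2.const_mul _),
      integral_const_mul, integral_const_mul, integral_pow_mul_exp_neg_mul 0 hpos,
      integral_pow_mul_exp_neg_mul 2 hpos, integral_pow_mul_exp_neg_mul 3 hpos]
    norm_num [Nat.factorial]
    field_simp
    ring
  have tail : ∫ x in Set.Ioi (1 : ℝ), F x ≤ 2 / a ^ 2 / a := by
    have e1 : ∫ x in Set.Ioi (1 : ℝ), Real.exp (-a * x) = Real.exp (-a) / a := by
      rw [integral_exp_mul_Ioi (by linarith) 1]
      field_simp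
    have i1 : IntegrableOn (fun x : ℝ => Real.exp (-a * x)) (Set.Ioi 1) :=
      integrableOn_exp_mul_Ioi (by linarith) 1
    calc ∫ x in Set.Ioi (1 : ℝ), F x ≤ ∫ x in Set.Ioi (1 : ℝ), Real.exp (-a * x) := by
          refine setIntegral_mono_on (iF.mono_set (Set.Ioi_subset_Ioi zero_le_one)) i1
            measurableSet_Ioi fun x hx => ?_
          have hx0 : (0 : ℝ) ≤ x := zero_le_one.trans (le_of_lt hx)
          rw [hFx, neg_mul]
          refine mul_le_of_le_one_right (Real.exp_pos _).le ?_
          have : 0 ≤ b * x ^ 2 / 2 := by positivity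
          have : 0 ≤ a * x ^ 3 / 2 := by positivity
          linarith
      _ = Real.exp (-a) / a := e1
      _ ≤ 2 / a ^ 2 / a := by
          gcongr
          rw [Real.exp_neg, le_div_iff₀ (by positivity), inv_mul_le_iff₀ (Real.exp_pos _)]
          nlinarith [Real.quadratic_le_exp_of_nonneg hpos.le]
  have split : ∫ x in Set.Ioc (0 : ℝ) 1, F x =
      (∫ x in Set.Ioi (0 : ℝ), F x) - ∫ x in Set.Ioi (1 : ℝ), F x := by
    rw [← Set.Ioc_union_Ioi_eq_Ioi (zero_le_one' ℝ), setIntegral_union _ measurableSet_Ioi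
      (iF.mono_set Set.Ioc_subset_Ioi_self) (iF.mono_set (Set.Ioi_subset_Ioi zero_le_one))]
    · ring
    · exact Set.disjoint_left.2 fun x hx hx' => not_lt_of_ge hx.2 hx'
  rw [intervalIntegral.integral_of_le zero_le_one]
  calc _ = (∫ x in Set.Ioi (0 : ℝ), F x) - 2 / a ^ 2 / a := by rw [intF]; ring
    _ ≤ ∫ x in Set.Ioc (0 : ℝ) 1, F x := by rw [split]; linarith
    _ ≤ _ := by
      refine setIntegral_mono_on (iF.mono_set Set.Ioc_subset_Ioi_self) ?_ measurableSet_Ioc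
        fun x hx => ?_
      · exact ((by fun_prop : Continuous fun x : ℝ =>
          (1 - x) ^ d * ∏ j ∈ s, (1 - x * y j)).integrableOn_Icc).mono_set Set.Ioc_subset_Icc_self
      · rw [hFx, ha, hb]
        exact exp_neg_mul_le_pow_mul_prod d s y h0 h1 hx.1.le hx.2

end factor

/-! ### Expansion of the product over the men. -/

/-- Passes from the sums with one man erased to the full sums U, V, so that the main term y/U - V/U²
can be summed over the men. Since y ≤ 1 and b ≤ a, every other contribution is O(1/U²). -/
theorem normalized_upper {U a b y V : ℝ} (hU : 40 ≤ U) (hy0 : 0 ≤ y) (hy1 : y ≤ 1)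
    (ha : a = U - y) (hb : b = V - y ^ 2) (hb0 : 0 ≤ b) (hba : b ≤ a) (hV : 0 ≤ V) :
    U * (1 / a * (1 - b / a ^ 2 + 3 * (b / a ^ 2) ^ 2)) ≤
      1 + (y / U - V / U ^ 2 + 10 / U ^ 2) := by
  have hUp : 0 < U := by linarith
  have hap : 0 < a := by linarith
  have haU : 39 / 40 * U ≤ a := by linarith
  set p := y / a with hp
  set r := b / a ^ 2 with hr
  have hp0 : 0 ≤ p := by positivity
  have hp1 : p ≤ 1 := by rw [hp, div_le_one hap]; linarith
  have hUa : U * (1 / a) = 1 + p := by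
    have : U = a + y := by rw [ha]; ring
    rw [hp, this]
    field_simp
  have hpU : p ≤ y / U + 1.03 / U ^ 2 := by
    rw [hp, div_add_div _ _ hUp.ne' (by positivity), div_le_div_iff₀ hap (by positivity), ha]
    have k1 : U * y ^ 2 ≤ U * 1 := by gcongr; nlinarith
    have k2 : U ^ 2 * y ^ 2 ≤ U ^ 2 * 1 := by gcongr; nlinarith
    nlinarith
  have hrV : V / U ^ 2 - 1 / U ^ 2 ≤ r := by
    calc V / U ^ 2 - 1 / U ^ 2 = (V - 1) / U ^ 2 := by ring
      _ ≤ b / U ^ 2 := by gcongr; nlinarith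
      _ ≤ r := by rw [hr]; gcongr; linarith
  have hr1 : 3 * r ^ 2 ≤ 3.2 / U ^ 2 := by
    have h1 : r ≤ 1 / a := by
      rw [hr, div_le_div_iff₀ (by positivity) hap]; nlinarith
    have h2 : r ≤ 40 / 39 / U := h1.trans (by
      rw [div_div, div_le_div_iff₀ hap (by positivity)]; linarith)
    have h3 : 0 ≤ r := by positivity
    calc 3 * r ^ 2 ≤ 3 * (40 / 39 / U) ^ 2 := by gcongr
      _ = (3 * (40 / 39) ^ 2) / U ^ 2 := by ring
      _ ≤ 3.2 / U ^ 2 := by gcongr; norm_num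
  have e : U * (1 / a * (1 - r + 3 * r ^ 2)) = (1 + p) * (1 - r + 3 * r ^ 2) := by
    rw [← mul_assoc, hUa]
  rw [e]
  have hv : 0 ≤ V / U ^ 2 := by positivity
  have hu : 0 ≤ 1 / U ^ 2 := by positivity
  have e1 : 1.03 / U ^ 2 = 1.03 * (1 / U ^ 2) := by ring
  have e2 : 3.2 / U ^ 2 = 3.2 * (1 / U ^ 2) := by ring
  have e3 : 10 / U ^ 2 = 10 * (1 / U ^ 2) := by ring
  rw [e1] at hpU
  rw [e2] at hr1
  rw [e3]
  have hm : (1 + p) * (1 - r + 3 * r ^ 2) ≤ (1 + p) * (1 - V / U ^ 2 + 4.2 * (1 / U ^ 2)) := by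
    exact mul_le_mul_of_nonneg_left (by linarith) (by linarith)
  nlinarith [mul_nonneg hp0 hv, mul_le_mul_of_nonneg_right hp1 hu]

theorem normalized_lower {U a b y V : ℝ} (hU : 40 ≤ U) (hy0 : 0 ≤ y) (hy1 : y ≤ 1)
    (ha : a = U - y) (hb : b = V - y ^ 2) (hV : 0 ≤ V) (hVU : V ≤ U) :
    1 + (y / U - V / U ^ 2 - 10 / U ^ 2) ≤ U * (1 / a * (1 - b / a ^ 2 - 5 / a ^ 2)) := by
  have hUp : 0 < U := by linarith
  have hap : 0 < a := by linarith
  have haU : 39 / 40 * U ≤ a := by linarith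
  set p := y / a with hp
  have hp0 : 0 ≤ p := by positivity
  have hUa : U * (1 / a) = 1 + p := by
    have : U = a + y := by rw [ha]; ring
    rw [hp, this]
    field_simp
  have hpU : y / U ≤ p := by rw [hp]; gcongr; linarith
  have hq : b / a ^ 2 + 5 / a ^ 2 ≤ V / U ^ 2 + 7.5 * (1 / U ^ 2) := by
    calc b / a ^ 2 + 5 / a ^ 2 = (b + 5) / a ^ 2 := by ring
      _ ≤ (V + 7.5) / U ^ 2 := by
        rw [div_le_div_iff₀ (by positivity) (by positivity), hb, ha]
        have k1 : V * (U * y) ≤ U * (U * 1) := by gcongr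
        have k2 : 0 ≤ V * y ^ 2 := by positivity
        have k3 : U * y ≤ U := by nlinarith
        have k4 : 0 ≤ U ^ 2 * y ^ 2 := by positivity
        have k5 : U * 40 ≤ U ^ 2 := by nlinarith
        nlinarith [sq_nonneg y]
      _ = _ := by ring
  have e : U * (1 / a * (1 - b / a ^ 2 - 5 / a ^ 2)) =
      (1 + p) * (1 - (b / a ^ 2 + 5 / a ^ 2)) := by
    rw [← mul_assoc, hUa]; ring
  rw [e]
  have hu1 : 1 / U ≤ 1 / 40 := by gcongr
  have hu2 : 1 / U ^ 2 = (1 / U) ^ 2 := by ring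
  have hu0 : 0 < 1 / U := by positivity
  have hv0 : 0 ≤ V / U ^ 2 := by positivity
  have hv : V / U ^ 2 ≤ 1 / U := by
    rw [div_le_div_iff₀ (by positivity) hUp]; nlinarith
  have hyU : y / U ≤ 1 / U := by gcongr
  have hyU0 : 0 ≤ y / U := by positivity
  set w := V / U ^ 2 + 7.5 * (1 / U ^ 2) with hw
  have hw1 : w ≤ 1.2 * (1 / U) := by rw [hw, hu2]; nlinarith
  calc 1 + (y / U - V / U ^ 2 - 10 / U ^ 2) = 1 + y / U - V / U ^ 2 - 10 * (1 / U) ^ 2 := by ring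
    _ ≤ (1 + y / U) * (1 - w) := by
      have : y / U * w ≤ 1 / U * (1.2 * (1 / U)) := by gcongr
      rw [hu2] at hw
      nlinarith
    _ ≤ (1 + p) * (1 - w) := by
      have : 0 ≤ 1 - w := by linarith
      gcongr
    _ ≤ _ := by gcongr

/-- Turns a lower bound 1 + z into an exponential, via log(1+z) ≥ z/(1+z). -/
theorem exp_sub_two_sq_le {z : ℝ} (hz : |z| ≤ 1 / 2) : Real.exp (z - 2 * z ^ 2) ≤ 1 + z := by
  have h := abs_le.1 hz
  have hp : 0 < 1 + z := by linarith
  rw [← Real.le_log_iff_exp_le hp]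
  refine le_trans ?_ (Real.one_sub_inv_le_log_of_pos hp)
  have e : 1 - (1 + z)⁻¹ = z / (1 + z) := by field_simp; ring
  rw [e, le_div_iff₀ hp]
  nlinarith [sq_nonneg z, mul_nonneg (sq_nonneg z) (by linarith : 0 ≤ 1 + 2 * z)]

section

variable {n : ℕ} (d : ℕ) (y : Fin n → ℝ)

/-- The integrand of the expected number of stable matchings, up to the factor
`(d + ∑ y)⁻ⁿ`. -/
noncomputable def correction : ℝ := ∏ i, ((d + ∑ j, y j) * manFactor d y i)

/-- The leading term of the logarithm of `correction`. -/
noncomputable def logCorrection : ℝ :=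
  (∑ j, y j) / (d + ∑ j, y j) - n * (d + ∑ j, y j ^ 2) / (d + ∑ j, y j) ^ 2

variable {d y}

theorem manFactor_nonneg (h0 : ∀ i, 0 ≤ y i) (h1 : ∀ i, y i ≤ 1) (i : Fin n) :
    0 ≤ manFactor d y i := by
  refine intervalIntegral.integral_nonneg zero_le_one fun x hx => mul_nonneg
    (pow_nonneg (by linarith [hx.2]) _) (Finset.prod_nonneg fun j _ => ?_)
  have := mul_le_one₀ hx.2 (h0 j) (h1 j)
  linarith

theorem correction_nonneg (h0 : ∀ i, 0 ≤ y i) (h1 : ∀ i, y i ≤ 1) : 0 ≤ correction d y :=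
  Finset.prod_nonneg fun i _ => mul_nonneg
    (add_nonneg d.cast_nonneg (Finset.sum_nonneg fun j _ => h0 j)) (manFactor_nonneg h0 h1 i)

theorem sum_erase_eq (f : Fin n → ℝ) (i : Fin n) :
    ∑ j ∈ Finset.univ.erase i, f j = (∑ j, f j) - f i := by
  rw [← Finset.sum_erase_add _ _ (Finset.mem_univ i)]; ring

/-- A crude bound that needs no largeness of U; it supplies domination and covers the atypical y and
t. Since d ≥ 1, U - yᵢ ≥ 1 ≥ yᵢ, which gives U/(U-yᵢ) ≤ 1 + 2yᵢ/U. -/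
theorem correction_le (hd : 1 ≤ d) (h0 : ∀ i, 0 ≤ y i) (h1 : ∀ i, y i ≤ 1) :
    correction d y ≤ Real.exp 2 := by
  set U := (d : ℝ) + ∑ j, y j with hU
  have hd' : (1 : ℝ) ≤ d := by exact_mod_cast hd
  have hs : 0 ≤ ∑ j, y j := Finset.sum_nonneg fun j _ => h0 j
  have hUp : 0 < U := by positivity
  have hfac : ∀ i ∈ Finset.univ, U * manFactor d y i ≤ Real.exp (2 * y i / U) := by
    intro i _
    have hsi : 0 ≤ ∑ j ∈ Finset.univ.erase i, y j := Finset.sum_nonneg fun j _ => h0 j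
    have ha : U - y i = d + ∑ j ∈ Finset.univ.erase i, y j := by rw [sum_erase_eq, hU]; ring
    have hap : 0 < U - y i := by rw [ha]; positivity
    have hle := integral_pow_mul_prod_le_inv d (Finset.univ.erase i) y (fun j _ => h0 j)
      (fun j _ => h1 j) ha hap
    have h2 : 2 * y i ≤ U := by
      have := h1 i
      have : U - y i ≥ 1 := by rw [ha]; linarith
      linarith
    calc U * manFactor d y i ≤ U * (1 / (U - y i)) := by
          rw [manFactor]
          gcongr
      _ ≤ 1 + 2 * y i / U := by
          rw [← sub_nonneg]
          have : 1 + 2 * y i / U - U * (1 / (U - y i)) = y i * (U - 2 * y i) / (U * (U - y i)) := by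
            field_simp
            ring
          rw [this]
          exact div_nonneg (mul_nonneg (h0 i) (by linarith)) (by positivity)
      _ ≤ Real.exp (2 * y i / U) := by linarith [Real.add_one_le_exp (2 * y i / U)]
  refine (Finset.prod_le_prod (fun i _ => mul_nonneg hUp.le (manFactor_nonneg h0 h1 i)) hfac).trans
    ?_
  rw [← Real.exp_sum, ← Finset.sum_div, ← Finset.mul_sum]
  gcongr
  rw [div_le_iff₀ hUp, hU]
  nlinarith

/-- Multiplies the one-man expansions. The 15 covers the 10 of `normalized_lower` plus 2z² ≤
2·1.25²/U² from `exp_sub_two_sq_le`. -/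
theorem correction_bounds (h0 : ∀ i, 0 ≤ y i) (h1 : ∀ i, y i ≤ 1) (hU40 : 40 ≤ d + ∑ j, y j) :
    Real.exp (logCorrection d y - 15 * (n / (d + ∑ j, y j) ^ 2)) ≤ correction d y ∧
      correction d y ≤ Real.exp (logCorrection d y + 15 * (n / (d + ∑ j, y j) ^ 2)) := by
  rw [correction, logCorrection]
  set U := (d : ℝ) + ∑ j, y j with hU
  set V := (d : ℝ) + ∑ j, y j ^ 2 with hV
  have hUp : 0 < U := by linarith
  have hV0 : 0 ≤ V := by positivity
  have hyy : ∀ j, y j ^ 2 ≤ y j := fun j => by nlinarith [h0 j, h1 j]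
  have hVU : V ≤ U := by
    rw [hU, hV]
    gcongr with j
    exact hyy j
  have sumeq : ∀ c : ℝ, ∑ i, (y i / U - V / U ^ 2 + c / U ^ 2) =
      (∑ j, y j) / U - n * V / U ^ 2 + c * (n / U ^ 2) := by
    intro c
    rw [Finset.sum_add_distrib, Finset.sum_sub_distrib, ← Finset.sum_div]
    simp
    ring
  have facts : ∀ i, 0 < U - y i ∧ U - y i = d + ∑ j ∈ Finset.univ.erase i, y j ∧
      V - y i ^ 2 = d + ∑ j ∈ Finset.univ.erase i, y j ^ 2 ∧ 0 ≤ V - y i ^ 2 ∧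
      V - y i ^ 2 ≤ U - y i := by
    intro i
    have e1 : U - y i = d + ∑ j ∈ Finset.univ.erase i, y j := by rw [sum_erase_eq, hU]; ring
    have e2 : V - y i ^ 2 = d + ∑ j ∈ Finset.univ.erase i, y j ^ 2 := by
      rw [sum_erase_eq (fun j => y j ^ 2), hV]; ring
    refine ⟨by linarith [h1 i], e1, e2, by rw [e2]; positivity, ?_⟩
    rw [e1, e2]
    gcongr with j
    exact hyy j
  constructor
  · have e : (∑ j, y j) / U - n * V / U ^ 2 - 15 * (n / U ^ 2) =
        ∑ i, (y i / U - V / U ^ 2 + (-15) / U ^ 2) := by rw [sumeq]; ring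
    rw [e, Real.exp_sum]
    refine Finset.prod_le_prod (fun i _ => (Real.exp_pos _).le) fun i _ => ?_
    obtain ⟨f1, f2, f3, f4, f5⟩ := facts i
    have hlow := normalized_lower hU40 (h0 i) (h1 i) rfl rfl hV0 hVU
    have hint := le_integral_pow_mul_prod d (Finset.univ.erase i) y (fun j _ => h0 j)
      (fun j _ => h1 j) f2 f3 f1
    set z := y i / U - V / U ^ 2 - 10 / U ^ 2 with hz
    have hu1 : 1 / U ≤ 1 / 40 := by gcongr
    have hu0 : 0 < 1 / U := by positivity
    have k1 : y i / U ≤ 1 / U := by have := h1 i; gcongr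
    have k2 : 0 ≤ y i / U := by have := h0 i; positivity
    have k3 : 0 ≤ V / U ^ 2 := by positivity
    have k4 : V / U ^ 2 ≤ 1 / U := by rw [div_le_div_iff₀ (by positivity) hUp]; nlinarith
    have k5 : 10 / U ^ 2 = 10 * (1 / U) ^ 2 := by ring
    have hzabs : |z| ≤ 1.25 * (1 / U) := by
      rw [abs_le, hz, k5]
      constructor <;> nlinarith
    have hz2 : z ^ 2 ≤ (1.25 * (1 / U)) ^ 2 := sq_le_sq' (by linarith [(abs_le.1 hzabs).1])
      (abs_le.1 hzabs).2
    calc Real.exp (y i / U - V / U ^ 2 + (-15) / U ^ 2) ≤ Real.exp (z - 2 * z ^ 2) := by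
          gcongr
          have : (-15) / U ^ 2 = -15 * (1 / U) ^ 2 := by ring
          rw [this]
          have := sq_nonneg (1 / U)
          rw [hz, k5] at *
          nlinarith
      _ ≤ 1 + z := exp_sub_two_sq_le (by linarith)
      _ ≤ _ := hlow
      _ ≤ U * manFactor d y i := by
          rw [manFactor]
          gcongr
  · rw [← sumeq, Real.exp_sum]
    refine Finset.prod_le_prod (fun i _ => mul_nonneg hUp.le (manFactor_nonneg h0 h1 i))
      fun i _ => ?_
    obtain ⟨f1, f2, f3, f4, f5⟩ := facts i
    have hup := normalized_upper hU40 (h0 i) (h1 i) rfl rfl f4 f5 hV0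
    have hint := integral_pow_mul_prod_le d (Finset.univ.erase i) y (fun j _ => h0 j)
      (fun j _ => h1 j) f2 f3 f1
    calc U * manFactor d y i ≤ U * _ := by
          rw [manFactor]
          gcongr
      _ ≤ _ := hup
      _ ≤ Real.exp (y i / U - V / U ^ 2 + 10 / U ^ 2) := by
          linarith [Real.add_one_le_exp (y i / U - V / U ^ 2 + 10 / U ^ 2)]
      _ ≤ _ := by
          gcongr
          norm_num

end

/-! ### Concentration of the beta weight around s. -/

/-- If `T` has density proportional to `betaWeight d n` on `(0, ∞)`, then `exp (-T)` has the beta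
distribution with parameters `d` and `n + 1`. -/
noncomputable def betaWeight (d n : ℕ) (t : ℝ) : ℝ :=
  Real.exp (-(d * t)) * (1 - Real.exp (-t)) ^ n

/-- The unnormalised moments of `betaWeight d n`. -/
noncomputable def betaMoment (j d n : ℕ) : ℝ :=
  ∫ t in Set.Ioi (0 : ℝ), t ^ j * betaWeight d n t

@[fun_prop]
theorem continuous_betaWeight (d n : ℕ) : Continuous (betaWeight d n) := by
  unfold betaWeight
  fun_prop

theorem one_sub_exp_neg_nonneg {t : ℝ} (ht : 0 ≤ t) : 0 ≤ 1 - Real.exp (-t) := by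
  simpa using ht

theorem one_sub_exp_neg_le_one (t : ℝ) : 1 - Real.exp (-t) ≤ 1 := by
  linarith [Real.exp_pos (-t)]

theorem betaWeight_nonneg (d n : ℕ) {t : ℝ} (ht : 0 ≤ t) : 0 ≤ betaWeight d n t :=
  mul_nonneg (Real.exp_pos _).le (pow_nonneg (one_sub_exp_neg_nonneg ht) n)

theorem integrableOn_pow_mul_betaWeight (j n : ℕ) {d : ℕ} (hd : 1 ≤ d) :
    IntegrableOn (fun t => t ^ j * betaWeight d n t) (Set.Ioi 0) := by
  refine (integrableOn_pow_mul_exp_neg_mul j (a := d) (by exact_mod_cast hd)).mono'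
    (Continuous.aestronglyMeasurable (by fun_prop)) ?_
  filter_upwards [ae_restrict_mem measurableSet_Ioi] with t ht
  have ht' : (0 : ℝ) ≤ t := le_of_lt ht
  rw [Real.norm_of_nonneg (mul_nonneg (pow_nonneg ht' j) (betaWeight_nonneg d n ht'))]
  refine mul_le_mul_of_nonneg_left ?_ (pow_nonneg ht' j)
  exact mul_le_of_le_one_right (Real.exp_pos _).le
    (pow_le_one₀ (one_sub_exp_neg_nonneg ht') (one_sub_exp_neg_le_one t))

/-- Expands one factor 1 - e^{-t}; all the moments below are computed by induction from this
recursion. -/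
theorem betaMoment_succ (j n : ℕ) {d : ℕ} (hd : 1 ≤ d) :
    betaMoment j d (n + 1) = betaMoment j d n - betaMoment j (d + 1) n := by
  rw [betaMoment, betaMoment, betaMoment,
    ← integral_sub (integrableOn_pow_mul_betaWeight j n hd)
      (integrableOn_pow_mul_betaWeight j n (by lia))]
  congr 1 with t
  have : Real.exp (-(((d + 1 : ℕ) : ℝ) * t)) = Real.exp (-(d * t)) * Real.exp (-t) := by
    rw [← Real.exp_add]; push_cast; ring_nf
  rw [betaWeight, betaWeight, betaWeight, this]
  ring

theorem betaMoment_zero_right (j d : ℕ) (hd : 1 ≤ d) :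
    betaMoment j d 0 = j.factorial / (d : ℝ) ^ (j + 1) := by
  rw [← integral_pow_mul_exp_neg_mul j (by exact_mod_cast hd)]
  simp [betaMoment, betaWeight]

theorem betaMoment_zero (n : ℕ) : ∀ d : ℕ, betaMoment 0 (d + 1) n =
    d.factorial * n.factorial / ((d + 1 + n).factorial : ℝ) := by
  induction n with
  | zero =>
    intro d
    rw [betaMoment_zero_right 0 _ (by lia)]
    simp only [Nat.factorial_zero, Nat.cast_one, add_zero, Nat.factorial_succ]
    push_cast
    have : (d.factorial : ℝ) ≠ 0 := by positivity
    field_simp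
  | succ n ih =>
    intro d
    rw [betaMoment_succ 0 n (by lia), ih, ih]
    have e : d + 1 + 1 + n = d + 1 + (n + 1) := by ring
    rw [e, ← add_assoc, Nat.factorial_succ (d + 1 + n), Nat.factorial_succ d,
      Nat.factorial_succ n]
    push_cast
    field_simp
    ring

theorem betaMoment_zero_pos (n : ℕ) {d : ℕ} (hd : 1 ≤ d) : 0 < betaMoment 0 d n := by
  obtain ⟨k, rfl⟩ := Nat.exists_eq_add_of_le' hd
  rw [betaMoment_zero]
  positivity

theorem betaMoment_zero_eq_mul_succ (n : ℕ) {d : ℕ} (hd : 1 ≤ d) :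
    (n + 1) * betaMoment 0 d n = (d + n + 1) * betaMoment 0 d (n + 1) := by
  obtain ⟨k, rfl⟩ := Nat.exists_eq_add_of_le' hd
  rw [betaMoment_zero, betaMoment_zero, ← add_assoc, Nat.factorial_succ (k + 1 + n),
    Nat.factorial_succ n]
  push_cast
  field_simp

theorem betaMoment_zero_succ_eq_mul_succ (n : ℕ) {d : ℕ} (hd : 1 ≤ d) :
    (n + 1) * betaMoment 0 (d + 1) n = d * betaMoment 0 d (n + 1) := by
  have h1 := betaMoment_zero_eq_mul_succ n hd
  have h2 := betaMoment_succ 0 n hd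
  have : betaMoment 0 (d + 1) n = betaMoment 0 d n - betaMoment 0 d (n + 1) := by linarith
  rw [this, mul_sub, h1]
  ring

/-- The sum `1 / d + ⋯ + 1 / (d + n)`. -/
noncomputable def harm (d n : ℕ) : ℝ := ∑ i ∈ Finset.range (n + 1), 1 / ((d : ℝ) + i)

/-- The sum `1 / d ^ 2 + ⋯ + 1 / (d + n) ^ 2`. -/
noncomputable def harmSq (d n : ℕ) : ℝ := ∑ i ∈ Finset.range (n + 1), 1 / ((d : ℝ) + i) ^ 2

theorem harm_succ (d n : ℕ) : harm d (n + 1) = harm d n + 1 / (d + n + 1) := by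
  rw [harm, Finset.sum_range_succ, harm]
  push_cast
  ring

theorem harm_succ' (d n : ℕ) : harm d (n + 1) = harm (d + 1) n + 1 / d := by
  rw [harm, Finset.sum_range_succ', harm]
  push_cast
  simp only [add_zero]
  congr 2 with i
  ring

theorem harmSq_succ (d n : ℕ) : harmSq d (n + 1) = harmSq d n + 1 / (d + n + 1) ^ 2 := by
  rw [harmSq, Finset.sum_range_succ, harmSq]
  push_cast
  ring

theorem harmSq_succ' (d n : ℕ) : harmSq d (n + 1) = harmSq (d + 1) n + 1 / d ^ 2 := by
  rw [harmSq, Finset.sum_range_succ', harmSq]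
  push_cast
  simp only [add_zero]
  congr 2 with i
  ring

/-- Normalized, the weight has the mean and variance of a sum of independent exponentials of rates
d, …, d+n. The recursion lowers n while raising d, so d is quantified inside the induction. -/
theorem betaMoment_one_two (n : ℕ) : ∀ d : ℕ, 1 ≤ d →
    betaMoment 1 d n = betaMoment 0 d n * harm d n ∧
    betaMoment 2 d n = betaMoment 0 d n * (harm d n ^ 2 + harmSq d n) := by
  induction n with
  | zero =>
    intro d hd
    have : (d : ℝ) ≠ 0 := by positivity
    simp only [betaMoment_zero_right _ _ hd, harm, harmSq]
    constructor
    · simp; field_simp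
    · simp; field_simp; norm_num
  | succ n ih =>
    intro d hd
    have hd0 : (d : ℝ) ≠ 0 := by positivity
    have hdn : (d : ℝ) + n + 1 ≠ 0 := by positivity
    have hn : (n : ℝ) + 1 ≠ 0 := by positivity
    have e1 : betaMoment 0 d n = (d + n + 1) * betaMoment 0 d (n + 1) / (n + 1) := by
      rw [eq_div_iff hn, ← betaMoment_zero_eq_mul_succ n hd]; ring
    have e2 : betaMoment 0 (d + 1) n = d * betaMoment 0 d (n + 1) / (n + 1) := by
      rw [eq_div_iff hn, ← betaMoment_zero_succ_eq_mul_succ n hd]; ring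
    have h1 : harm d n = harm d (n + 1) - 1 / (d + n + 1) := by rw [harm_succ]; ring
    have h2 : harm (d + 1) n = harm d (n + 1) - 1 / d := by rw [harm_succ']; ring
    have h3 : harmSq d n = harmSq d (n + 1) - 1 / (d + n + 1) ^ 2 := by rw [harmSq_succ]; ring
    have h4 : harmSq (d + 1) n = harmSq d (n + 1) - 1 / d ^ 2 := by rw [harmSq_succ']; ring
    rw [betaMoment_succ 1 n hd, betaMoment_succ 2 n hd, (ih d hd).1, (ih d hd).2,
      (ih (d + 1) (by lia)).1, (ih (d + 1) (by lia)).2, e1, e2, h1, h2, h3, h4]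
    generalize betaMoment 0 d (n + 1) = B
    generalize harm d (n + 1) = H
    generalize harmSq d (n + 1) = K
    constructor
    · field_simp; ring
    · field_simp; ring

theorem integral_sq_sub_mul_betaWeight (n : ℕ) {d : ℕ} (hd : 1 ≤ d) (s : ℝ) :
    IntegrableOn (fun t => (t - s) ^ 2 * betaWeight d n t) (Set.Ioi 0) ∧
    ∫ t in Set.Ioi (0 : ℝ), (t - s) ^ 2 * betaWeight d n t =
      betaMoment 0 d n * ((harm d n - s) ^ 2 + harmSq d n) := by
  have i0 := integrableOn_pow_mul_betaWeight 0 n hd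
  have i1 := integrableOn_pow_mul_betaWeight 1 n hd
  have i2 := integrableOn_pow_mul_betaWeight 2 n hd
  have i21 : IntegrableOn (fun t => t ^ 2 * betaWeight d n t -
    2 * s * (t ^ 1 * betaWeight d n t)) (Set.Ioi 0) := i2.sub (i1.const_mul _)
  have e : (fun t => (t - s) ^ 2 * betaWeight d n t) = fun t =>
      t ^ 2 * betaWeight d n t - 2 * s * (t ^ 1 * betaWeight d n t) +
        s ^ 2 * (t ^ 0 * betaWeight d n t) := by
    funext t; ring
  rw [e]
  refine ⟨i21.add (i0.const_mul _), ?_⟩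
  rw [integral_add i21 (i0.const_mul _), integral_sub i2 (i1.const_mul _), integral_const_mul,
    integral_const_mul, ← betaMoment, ← betaMoment, ← betaMoment, (betaMoment_one_two n d hd).1,
    (betaMoment_one_two n d hd).2]
  ring

theorem harm_sub_log_bounds (n : ℕ) {d : ℕ} (hd : 1 ≤ d) :
    Real.log ((d + n + 1) / d) ≤ harm d n ∧ harm d n ≤ Real.log ((d + n) / d) + 1 / d := by
  have hd0 : (0 : ℝ) < d := by exact_mod_cast hd
  induction n with
  | zero =>
    simp only [harm, Nat.cast_zero, zero_add, Finset.sum_range_one, add_zero, div_self hd0.ne',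
      Real.log_one, le_refl, and_true]
    refine (Real.log_le_sub_one_of_pos (by positivity)).trans (le_of_eq ?_)
    field_simp
    ring
  | succ n ih =>
    have hp : (0 : ℝ) < d + n + 1 := by positivity
    rw [harm_succ]
    push_cast
    constructor
    · have e : ((d : ℝ) + (n + 1) + 1) / d = (d + n + 1) / d * ((d + n + 2) / (d + n + 1)) := by
        field_simp; ring
      rw [e, Real.log_mul (by positivity) (by positivity)]
      have := Real.log_le_sub_one_of_pos (x := ((d : ℝ) + n + 2) / (d + n + 1)) (by positivity)
      have e2 : ((d : ℝ) + n + 2) / (d + n + 1) - 1 = 1 / (d + n + 1) := by field_simp; ring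
      linarith [ih.1]
    · have e : ((d : ℝ) + (n + 1)) / d = (d + n) / d * ((d + n + 1) / (d + n)) := by
        field_simp; ring
      rw [e, Real.log_mul (by positivity) (by positivity)]
      have := Real.one_sub_inv_le_log_of_pos (x := ((d : ℝ) + n + 1) / (d + n)) (by positivity)
      have e2 : 1 - (((d : ℝ) + n + 1) / (d + n))⁻¹ = 1 / (d + n + 1) := by field_simp; ring
      linarith [ih.2]

/-- The later terms telescope against 1/((d+n)(d+n+1)); the first is kept apart because d may be 1.
-/
theorem harmSq_le (n : ℕ) {d : ℕ} (hd : 1 ≤ d) :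
    harmSq d n ≤ 1 / d ^ 2 + n / (d * (d + n)) := by
  have hd0 : (0 : ℝ) < d := by exact_mod_cast hd
  induction n with
  | zero => simp [harmSq]
  | succ n ih =>
    rw [harmSq_succ]
    push_cast
    have : (n : ℝ) / (d * (d + n)) + 1 / (d + n + 1) ^ 2 ≤ (n + 1) / (d * (d + (n + 1))) := by
      have e : (n + 1 : ℝ) / (d * (d + (n + 1))) - n / (d * (d + n)) =
          1 / ((d + n) * (d + n + 1)) := by
        field_simp; ring
      have : 1 / ((d : ℝ) + n + 1) ^ 2 ≤ 1 / ((d + n) * (d + n + 1)) := by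
        rw [sq]
        exact one_div_le_one_div_of_le (by positivity) (by nlinarith)
      linarith
    linarith

/-- A bound for the mean squared deviation of the law `betaWeight d n` from `log ((d + n) / d)`. -/
noncomputable def betaVar (d n : ℕ) : ℝ := 2 / (d : ℝ) ^ 2 + n / (d * (d + n))

theorem integral_sq_sub_log_le (n : ℕ) {d : ℕ} (hd : 1 ≤ d) :
    ∫ t in Set.Ioi (0 : ℝ), (t - Real.log ((d + n) / d)) ^ 2 * betaWeight d n t ≤
      betaVar d n * betaMoment 0 d n := by
  have hd0 : (0 : ℝ) < d := by exact_mod_cast hd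
  rw [(integral_sq_sub_mul_betaWeight n hd _).2, mul_comm]
  refine mul_le_mul_of_nonneg_right ?_ (betaMoment_zero_pos n hd).le
  have h := harm_sub_log_bounds n hd
  have h2 := harmSq_le n hd
  have hl : Real.log ((d + n) / d) ≤ Real.log ((d + n + 1) / d) :=
    Real.log_le_log (by positivity) (div_le_div_of_nonneg_right (by linarith) hd0.le)
  have h3 : (harm d n - Real.log ((d + n) / d)) ^ 2 ≤ (1 / d) ^ 2 :=
    pow_le_pow_left₀ (by linarith) (by linarith) 2
  have e : (1 / (d : ℝ)) ^ 2 = 1 / d ^ 2 := by ring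
  have e2 : 2 / (d : ℝ) ^ 2 = 1 / d ^ 2 + 1 / d ^ 2 := by ring
  rw [betaVar, e2]
  linarith

/-- The weight has index n but the centre belongs to n + 1: this form is needed when one factor 1 -
e^{-t} has been spent on cancelling 1/t. -/
theorem integral_sq_sub_log_le_pred (n : ℕ) {d : ℕ} (hd : 1 ≤ d) :
    ∫ t in Set.Ioi (0 : ℝ), (t - Real.log ((d + (n + 1)) / d)) ^ 2 * betaWeight d n t ≤
      betaVar d (n + 1) * betaMoment 0 d n := by
  have hd0 : (0 : ℝ) < d := by exact_mod_cast hd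
  rw [(integral_sq_sub_mul_betaWeight n hd _).2, mul_comm]
  refine mul_le_mul_of_nonneg_right ?_ (betaMoment_zero_pos n hd).le
  have h := harm_sub_log_bounds n hd
  have hl : Real.log ((d + n) / d) ≤ Real.log ((d + (n + 1)) / d) :=
    Real.log_le_log (by positivity) (by gcongr; linarith)
  have h2 : harmSq d n ≤ 1 / d ^ 2 + ((n + 1 : ℕ) : ℝ) / (d * (d + (n + 1 : ℕ))) := by
    refine le_trans ?_ (harmSq_le (n + 1) hd)
    rw [harmSq_succ]
    have : (0 : ℝ) ≤ 1 / (d + n + 1) ^ 2 := by positivity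
    linarith
  rw [← add_assoc] at *
  have h3 : (harm d n - Real.log ((d + n + 1) / d)) ^ 2 ≤ (1 / d) ^ 2 :=
    pow_le_pow_left₀ (by linarith) (by linarith) 2
  have e : (1 / (d : ℝ)) ^ 2 = 1 / d ^ 2 := by ring
  have e2 : 2 / (d : ℝ) ^ 2 = 1 / d ^ 2 + 1 / d ^ 2 := by ring
  rw [betaVar, e2]
  linarith

/-- Bernoulli: (1 + n/d)^d ≥ 1 + n. This is the source of uniformity in d. -/
theorem log_one_add_le_mul_log {d : ℕ} (hd : 1 ≤ d) (n : ℕ) :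
    Real.log (1 + n) ≤ d * Real.log ((d + n) / d) := by
  have hd0 : (0 : ℝ) < d := by exact_mod_cast hd
  rw [← Real.log_pow]
  refine Real.log_le_log (by positivity) ?_
  have := one_add_mul_le_pow (a := (n : ℝ) / d) (by
    have : (0 : ℝ) ≤ n / d := by positivity
    linarith) d
  have e : ((d : ℝ) + n) / d = 1 + n / d := by field_simp
  rw [e]
  refine le_trans (le_of_eq ?_) this
  field_simp

/-- For n ≤ d, s ≥ n/(d+n) gives the stronger rate 10/n. For d < n, s ≥ 1/2 and the variance is at
most 3/d, so only d·s ≥ log(1+n) helps. The second bound includes the factor (d+n)/n lost on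
lowering the index of the weight by one. -/
theorem betaVar_bounds {d : ℕ} (hd : 1 ≤ d) {n : ℕ} (hn : 1 ≤ n) :
    betaVar d n / Real.log ((d + n) / d) ^ 2 ≤ 10 / Real.log (1 + n) ∧
    betaVar d n * (d + n) / (n * Real.log ((d + n) / d)) ≤ 10 / Real.log (1 + n) := by
  have hd0 : (0 : ℝ) < d := by exact_mod_cast hd
  have hn0 : (0 : ℝ) < n := by exact_mod_cast hn
  have hd1 : (1 : ℝ) ≤ d := by exact_mod_cast hd
  have hn1 : (1 : ℝ) ≤ n := by exact_mod_cast hn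
  set s := Real.log ((d + n) / d) with hs
  have hlog : 0 < Real.log (1 + n) := Real.log_pos (by linarith)
  have hlogn : Real.log (1 + n) ≤ n := by
    have := Real.log_le_sub_one_of_pos (x := 1 + (n : ℝ)) (by positivity)
    linarith
  have hv0 : 0 ≤ betaVar d n := by rw [betaVar]; positivity
  have hspos : 0 < s := Real.log_pos (by rw [one_lt_div hd0]; linarith)
  rcases le_or_gt n d with h | h
  · have h' : (n : ℝ) ≤ d := by exact_mod_cast h
    have hsn : n / (d + n) ≤ s := by
      have := Real.one_sub_inv_le_log_of_pos (x := ((d : ℝ) + n) / d) (by positivity)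
      refine le_trans (le_of_eq ?_) this
      field_simp
      ring
    have hr : betaVar d n / (n / (d + n)) ^ 2 ≤ 10 / n := by
      have e : betaVar d n / (n / (d + n)) ^ 2 = 2 * ((d + n) / (d * n)) ^ 2 + (d + n) / (d * n) := by
        rw [betaVar]
        field_simp
      have h1 : ((d : ℝ) + n) / (d * n) ≤ 2 / n := by
        rw [div_le_div_iff₀ (by positivity) hn0]; nlinarith
      have h0 : 0 ≤ ((d : ℝ) + n) / (d * n) := by positivity
      have h2 : (((d : ℝ) + n) / (d * n)) ^ 2 ≤ (2 / n) ^ 2 := pow_le_pow_left₀ h0 h1 2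
      have h3 : (2 / (n : ℝ)) ^ 2 ≤ 4 / n := by
        rw [div_pow]
        norm_num
        gcongr
        nlinarith
      have h4 : 10 / (n : ℝ) = 2 * (4 / n) + 2 / n := by ring
      rw [e, h4]
      linarith
    have hr' : 10 / (n : ℝ) ≤ 10 / Real.log (1 + n) := by gcongr
    refine ⟨le_trans ?_ (hr.trans hr'), le_trans ?_ (hr.trans hr')⟩
    · gcongr
    · have e : betaVar d n * (d + n) / (n * s) = betaVar d n / (n / (d + n) * s) := by
        field_simp
      rw [e, sq]
      gcongr
  · have h' : (d : ℝ) ≤ n := by exact_mod_cast h.le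
    have hs2 : 1 / 2 ≤ s := by
      have h2 : Real.log 2 ≤ s := Real.log_le_log two_pos (by rw [le_div_iff₀ hd0]; linarith)
      linarith [Real.log_two_gt_d9]
    have hv : betaVar d n ≤ 3 / d := by
      have h1 : 2 / (d : ℝ) ^ 2 ≤ 2 / d := by gcongr; nlinarith
      have h2 : (n : ℝ) / (d * (d + n)) ≤ 1 / d := by
        rw [div_le_div_iff₀ (by positivity) hd0]; nlinarith
      have h3 : 3 / (d : ℝ) = 2 / d + 1 / d := by ring
      rw [betaVar, h3]
      linarith
    have hds := log_one_add_le_mul_log hd n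
    rw [← hs] at hds
    have hr : 3 / (d : ℝ) * (2 / s) ≤ 10 / Real.log (1 + n) := by
      rw [div_mul_div_comm]
      gcongr
      norm_num
    refine ⟨le_trans ?_ hr, le_trans ?_ hr⟩
    · rw [div_eq_mul_one_div]
      gcongr ?_ * ?_
      rw [div_le_div_iff₀ (by positivity) hspos]
      nlinarith
    · have e : betaVar d n * (d + n) / (n * s) = betaVar d n * ((d + n) / n / s) := by
        field_simp
      rw [e]
      gcongr ?_ * (?_ / s)
      rw [div_le_iff₀ hn0]
      linarith

theorem integral_abs_log_div_sub_one_le {d : ℕ} (hd : 1 ≤ d) {n : ℕ} (hn : 1 ≤ n) {κ s : ℝ}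
    (hκ : κ = 10 / Real.log (1 + n)) (hs : s = Real.log ((d + n) / d)) :
    IntegrableOn (fun t => |s / t - 1| * betaWeight d n t) (Set.Ioi 0) ∧
    ∫ t in Set.Ioi (0 : ℝ), |s / t - 1| * betaWeight d n t ≤
      (2 * √κ + 4 * κ) * betaMoment 0 d n := by
  obtain ⟨m, rfl⟩ := Nat.exists_eq_add_of_le' hn
  have hd0 : (0 : ℝ) < d := by exact_mod_cast hd
  have hspos : 0 < s := hs ▸ Real.log_pos (by
    rw [one_lt_div hd0]; push_cast; linarith [m.cast_nonneg (α := ℝ)])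
  have hκ0 : 0 < κ := hκ ▸ div_pos (by norm_num) (Real.log_pos (by
    push_cast; linarith [m.cast_nonneg (α := ℝ)]))
  have hη : 0 < √κ := Real.sqrt_pos.2 hκ0
  set η := √κ with hηdef
  have hηκ : κ / η = η := by rw [hηdef, Real.div_sqrt]
  have i0 := integrableOn_pow_mul_betaWeight 0 (m + 1) hd
  have i1 := (integral_sq_sub_mul_betaWeight (m + 1) hd s).1
  have i2 := (integral_sq_sub_mul_betaWeight m hd s).1
  set F : ℝ → ℝ := fun t => η * (t ^ 0 * betaWeight d (m + 1) t) +
    1 / (η * s ^ 2) * ((t - s) ^ 2 * betaWeight d (m + 1) t) +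
    4 / s * ((t - s) ^ 2 * betaWeight d m t) with hF
  have i01 : IntegrableOn (fun t => η * (t ^ 0 * betaWeight d (m + 1) t) +
    1 / (η * s ^ 2) * ((t - s) ^ 2 * betaWeight d (m + 1) t)) (Set.Ioi 0) :=
    (i0.const_mul _).add (i1.const_mul _)
  have iF : IntegrableOn F (Set.Ioi 0) := i01.add (i2.const_mul _)
  have bound : ∀ t ∈ Set.Ioi (0 : ℝ), |s / t - 1| * betaWeight d (m + 1) t ≤ F t := by
    intro t ht
    have ht : 0 < t := ht
    have hw := betaWeight_nonneg d m ht.le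
    have hq : 0 < 1 - Real.exp (-t) := by simpa using ht
    have hqt : 1 - Real.exp (-t) ≤ t := by linarith [Real.add_one_le_exp (-t)]
    have hww : betaWeight d (m + 1) t = betaWeight d m t * (1 - Real.exp (-t)) := by
      rw [betaWeight, betaWeight, pow_succ]; ring
    have hw1 := betaWeight_nonneg d (m + 1) ht.le
    have e : |s / t - 1| = |t - s| / t := by
      rw [abs_sub_comm t s, ← abs_of_pos ht, ← abs_div, abs_of_pos ht, sub_div, div_self ht.ne']
    simp only [hF, pow_zero, one_mul]
    -- For t ≥ s/2 the ratio is controlled by |t-s|/s, split by the arithmetic-geometric inequality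
    -- with parameter η. For t < s/2, 1/t is unbounded: a factor 1 - e^{-t} ≤ t absorbs it, and s² ≤
    -- 4(t-s)² reduces to the variance, as in Chebyshev.
    rcases le_or_gt (s / 2) t with h | h
    · have h1 : |s / t - 1| ≤ η + 1 / (η * s ^ 2) * (t - s) ^ 2 := by
        rw [e]
        calc |t - s| / t ≤ |t - s| / (s / 2) := by gcongr
          _ = 2 * (|t - s| / s) := by field_simp
          _ ≤ η + (|t - s| / s) ^ 2 / η := by
            rw [← sub_nonneg]
            have : η + (|t - s| / s) ^ 2 / η - 2 * (|t - s| / s) =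
                (η - |t - s| / s) ^ 2 / η := by field_simp; ring
            rw [this]
            positivity
          _ = η + 1 / (η * s ^ 2) * (t - s) ^ 2 := by
            rw [div_pow, sq_abs]
            field_simp
      have h2 : 0 ≤ 4 / s * ((t - s) ^ 2 * betaWeight d m t) := by positivity
      nlinarith [mul_le_mul_of_nonneg_right h1 hw1]
    · have h1 : |s / t - 1| * betaWeight d (m + 1) t ≤ 4 / s * ((t - s) ^ 2 * betaWeight d m t) := by
        have h3 : |t - s| ≤ s := by rw [abs_le]; constructor <;> linarith
        have h4 : s ^ 2 ≤ 4 * (t - s) ^ 2 := by nlinarith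
        calc |s / t - 1| * betaWeight d (m + 1) t ≤
            s / (1 - Real.exp (-t)) * (betaWeight d m t * (1 - Real.exp (-t))) := by
              rw [e, hww]
              gcongr
          _ = s ^ 2 / s * betaWeight d m t := by field_simp
          _ ≤ 4 * (t - s) ^ 2 / s * betaWeight d m t := by gcongr
          _ = _ := by ring
      have h2 : 0 ≤ η * betaWeight d (m + 1) t +
        1 / (η * s ^ 2) * ((t - s) ^ 2 * betaWeight d (m + 1) t) := by positivity
      linarith
  have iG : IntegrableOn (fun t => |s / t - 1| * betaWeight d (m + 1) t) (Set.Ioi 0) := by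
    refine iF.mono' (Measurable.aestronglyMeasurable (by fun_prop)) ?_
    filter_upwards [ae_restrict_mem measurableSet_Ioi] with t ht
    rw [Real.norm_of_nonneg (mul_nonneg (abs_nonneg _) (betaWeight_nonneg _ _ (le_of_lt ht)))]
    exact bound t ht
  refine ⟨iG, (setIntegral_mono_on iG iF measurableSet_Ioi bound).trans ?_⟩
  simp only [hF]
  rw [integral_add i01 (i2.const_mul _), integral_add (i0.const_mul _) (i1.const_mul _),
    integral_const_mul, integral_const_mul, integral_const_mul, ← betaMoment]
  have b1 := integral_sq_sub_log_le (m + 1) hd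
  have b2 := integral_sq_sub_log_le_pred m hd
  rw [← hs] at b1
  have hs' : Real.log ((d + (m + 1)) / d) = s := by rw [hs]; push_cast; rfl
  rw [hs'] at b2
  obtain ⟨v1, v2⟩ := betaVar_bounds hd hn
  rw [← hs, ← hκ] at v1 v2
  have hB := betaMoment_zero_pos (m + 1) hd
  have hBm : betaMoment 0 d m = (d + (m + 1 : ℕ)) / (m + 1 : ℕ) * betaMoment 0 d (m + 1) := by
    have := betaMoment_zero_eq_mul_succ m hd
    push_cast
    field_simp
    linarith
  have t1 : 1 / (η * s ^ 2) * ∫ t in Set.Ioi (0 : ℝ), (t - s) ^ 2 * betaWeight d (m + 1) t ≤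
      η * betaMoment 0 d (m + 1) := by
    calc _ ≤ 1 / (η * s ^ 2) * (betaVar d (m + 1) * betaMoment 0 d (m + 1)) := by gcongr
      _ = betaVar d (m + 1) / s ^ 2 / η * betaMoment 0 d (m + 1) := by field_simp
      _ ≤ κ / η * betaMoment 0 d (m + 1) := by gcongr
      _ = _ := by rw [hηκ]
  have t2 : 4 / s * ∫ t in Set.Ioi (0 : ℝ), (t - s) ^ 2 * betaWeight d m t ≤
      4 * κ * betaMoment 0 d (m + 1) := by
    calc _ ≤ 4 / s * (betaVar d (m + 1) * betaMoment 0 d m) := by gcongr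
      _ = 4 * (betaVar d (m + 1) * (d + (m + 1 : ℕ)) / ((m + 1 : ℕ) * s)) *
          betaMoment 0 d (m + 1) := by rw [hBm]; field_simp
      _ ≤ _ := by gcongr
  linarith

/-! ### The function t/(eᵗ - 1) and its variation on the logarithmic scale. -/

/-- The function `t / (exp t - 1)`. -/
noncomputable def bose (t : ℝ) : ℝ := t / (Real.exp t - 1)

theorem exp_sub_one_pos {t : ℝ} (ht : 0 < t) : 0 < Real.exp t - 1 := by
  simpa using ht

theorem bose_nonneg {t : ℝ} (ht : 0 < t) : 0 ≤ bose t :=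
  div_nonneg ht.le (exp_sub_one_pos ht).le

theorem bose_le_one {t : ℝ} (ht : 0 < t) : bose t ≤ 1 := by
  rw [bose, div_le_one (exp_sub_one_pos ht)]
  linarith [Real.add_one_le_exp t]

theorem cubic_le_exp {t : ℝ} (ht : 0 ≤ t) : 1 + t + t ^ 2 / 2 + t ^ 3 / 6 ≤ Real.exp t := by
  have := Real.sum_le_exp_of_nonneg ht 4
  norm_num [Finset.sum_range_succ, Nat.factorial] at this
  linarith

/-- The cubic Taylor bound leaves t - t²/2 + t³/6 = (t/6)((t-3/2)² + 15/4) > 0. -/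
theorem mul_bose_le_one {t : ℝ} (ht : 0 < t) : t * bose t ≤ 1 := by
  rw [bose, mul_div_assoc', div_le_one (exp_sub_one_pos ht)]
  nlinarith [cubic_le_exp ht.le, mul_nonneg ht.le (sq_nonneg (t - 3 / 2))]

theorem sq_mul_bose_le {t : ℝ} (ht : 0 < t) : t ^ 2 * bose t ≤ 6 := by
  rw [bose, mul_div_assoc', div_le_iff₀ (exp_sub_one_pos ht)]
  nlinarith [cubic_le_exp ht.le, mul_pos ht ht]

/-- The form φ'(t)/t exhibits the derivative with respect to log t, which is bounded. -/
theorem hasDerivAt_bose {t : ℝ} (ht : 0 < t) :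
    HasDerivAt bose ((bose t - t * bose t - bose t ^ 2) / t) t := by
  have hp := exp_sub_one_pos ht
  have h := (hasDerivAt_id t).div ((Real.hasDerivAt_exp t).sub_const 1) hp.ne'
  refine h.congr_deriv ?_
  simp only [bose, id]
  field_simp
  ring

/-- A function that is Lipschitz in `log` and takes values in `[0, 1]` varies at most
proportionally to `s / t - 1`. -/
theorem abs_sub_le_of_log_lipschitz {φ φ' : ℝ → ℝ} {c : ℝ} (hc : 1 ≤ c)
    (h0 : ∀ x, 0 < x → 0 ≤ φ x) (h1 : ∀ x, 0 < x → φ x ≤ 1)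
    (hd : ∀ x, 0 < x → HasDerivAt φ (φ' x / x) x) (hb : ∀ x, 0 < x → |φ' x| ≤ c)
    {s t : ℝ} (hs : 0 < s) (ht : 0 < t) : |φ t - φ s| ≤ 2 * c * |s / t - 1| := by
  rcases le_or_gt (1 / 2) |s / t - 1| with h | h
  · have : |φ t - φ s| ≤ 1 := by
      rw [abs_le]
      constructor <;> linarith [h0 s hs, h1 s hs, h0 t ht, h1 t ht]
    nlinarith
  · have hmv : |φ t - φ s| ≤ c * |Real.log t - Real.log s| := by
      have hder : ∀ u ∈ Set.univ, HasDerivWithinAt (fun u => φ (Real.exp u))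
          (φ' (Real.exp u)) Set.univ u := by
        intro u _
        have := (hd _ (Real.exp_pos u)).comp u (Real.hasDerivAt_exp u)
        rw [div_mul_cancel₀ _ (Real.exp_pos u).ne'] at this
        exact this.hasDerivWithinAt
      have := Convex.norm_image_sub_le_of_norm_hasDerivWithin_le hder
        (fun u _ => hb _ (Real.exp_pos u)) convex_univ (Set.mem_univ (Real.log s))
        (Set.mem_univ (Real.log t))
      simpa [Real.exp_log hs, Real.exp_log ht] using this
    have hlog : |Real.log t - Real.log s| ≤ 2 * |s / t - 1| := by
      have hr : 0 < s / t := div_pos hs ht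
      have e : Real.log t - Real.log s = -Real.log (s / t) := by
        rw [Real.log_div hs.ne' ht.ne']; ring
      rw [e, abs_neg]
      obtain ⟨h2, h3⟩ := abs_lt.1 h
      have hup := Real.log_le_sub_one_of_pos hr
      have hlow := Real.one_sub_inv_le_log_of_pos hr
      have hlow' : 1 - (s / t)⁻¹ = (s / t - 1) / (s / t) := by field_simp
      rw [hlow', div_le_iff₀ hr] at hlow
      have h4 : s / t - 1 ≤ |s / t - 1| := le_abs_self _
      have h5 : -(s / t - 1) ≤ |s / t - 1| := neg_le_abs _
      have h6 := abs_nonneg (s / t - 1)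
      rw [abs_le]
      constructor
      · by_contra hcon
        push Not at hcon
        nlinarith
      · linarith
    nlinarith [abs_nonneg (s / t - 1)]

theorem abs_bose_sub_le {s t : ℝ} (hs : 0 < s) (ht : 0 < t) :
    |bose t - bose s| ≤ 4 * |s / t - 1| := by
  have := abs_sub_le_of_log_lipschitz (φ := bose) (c := 2) (by norm_num)
    (fun x hx => bose_nonneg hx) (fun x hx => bose_le_one hx) (fun x hx => hasDerivAt_bose hx)
    (fun x hx => ?_) hs ht
  · linarith
  · have a := bose_nonneg hx
    have b := bose_le_one hx
    have c := mul_bose_le_one hx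
    have d : 0 ≤ x * bose x := mul_nonneg hx.le a
    rw [abs_le]
    constructor <;> nlinarith

theorem abs_mul_bose_sub_le {s t : ℝ} (hs : 0 < s) (ht : 0 < t) :
    |t * bose t - s * bose s| ≤ 14 * |s / t - 1| := by
  have := abs_sub_le_of_log_lipschitz (φ := fun x => x * bose x)
    (φ' := fun x => 2 * (x * bose x) - x ^ 2 * bose x - x * bose x * bose x) (c := 7) (by norm_num)
    (fun x hx => mul_nonneg hx.le (bose_nonneg hx)) (fun x hx => mul_bose_le_one hx)
    (fun x hx => ?_) (fun x hx => ?_) hs ht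
  · linarith
  · refine ((hasDerivAt_id x).mul (hasDerivAt_bose hx)).congr_deriv ?_
    simp only [id]
    field_simp
    ring
  · have a := bose_nonneg hx
    have b := bose_le_one hx
    have c := mul_bose_le_one hx
    have d : 0 ≤ x * bose x := mul_nonneg hx.le a
    have e := sq_mul_bose_le hx
    have f : 0 ≤ x ^ 2 * bose x := mul_nonneg (sq_nonneg x) a
    rw [abs_le]
    constructor <;> nlinarith

/-! ### Truncated exponential thresholds and their law of large numbers. -/

/-- The density on `[0, 1]` of an exponential variable of rate `t` conditioned to be at most `1`. -/
noncomputable def truncExp (t y : ℝ) : ℝ := t / (1 - Real.exp (-t)) * Real.exp (-(t * y))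

theorem truncExp_nonneg {t : ℝ} (ht : 0 < t) (y : ℝ) : 0 ≤ truncExp t y :=
  mul_nonneg (div_nonneg ht.le (one_sub_exp_neg_nonneg ht.le)) (Real.exp_pos _).le

@[fun_prop]
theorem continuous_truncExp (t : ℝ) : Continuous (truncExp t) := by
  unfold truncExp
  fun_prop

theorem integral_truncExp {t : ℝ} (ht : 0 < t) : ∫ y in (0 : ℝ)..1, truncExp t y = 1 := by
  have hq : 0 < 1 - Real.exp (-t) := by simpa using ht
  have h : ∀ y ∈ Set.uIcc (0 : ℝ) 1,
      HasDerivAt (fun y => -(1 / (1 - Real.exp (-t))) * Real.exp (-(t * y))) (truncExp t y) y := by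
    intro y _
    have := (((hasDerivAt_id y).const_mul t).neg.exp).const_mul (-(1 / (1 - Real.exp (-t))))
    refine this.congr_deriv ?_
    simp [truncExp]
    ring
  rw [intervalIntegral.integral_eq_sub_of_hasDerivAt h
    (Continuous.intervalIntegrable (by fun_prop) _ _)]
  simp
  field_simp
  ring

theorem bose_eq {t : ℝ} : bose t = t * Real.exp (-t) / (1 - Real.exp (-t)) := by
  rw [bose, Real.exp_neg]
  have := (Real.exp_pos t).ne'
  field_simp

theorem integral_id_mul_truncExp {t : ℝ} (ht : 0 < t) :
    ∫ y in (0 : ℝ)..1, y * truncExp t y = (1 - bose t) / t := by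
  have hq : 0 < 1 - Real.exp (-t) := by simpa using ht
  have h : ∀ y ∈ Set.uIcc (0 : ℝ) 1,
      HasDerivAt (fun y => -(1 / (1 - Real.exp (-t))) * ((y + 1 / t) * Real.exp (-(t * y))))
        (y * truncExp t y) y := by
    intro y _
    have := ((((hasDerivAt_id y).add_const (1 / t)).mul
      ((hasDerivAt_id y).const_mul t).neg.exp)).const_mul (-(1 / (1 - Real.exp (-t))))
    refine this.congr_deriv ?_
    simp [truncExp]
    field_simp
    ring
  rw [intervalIntegral.integral_eq_sub_of_hasDerivAt h
    (Continuous.intervalIntegrable (by fun_prop) _ _), bose_eq]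
  simp
  field_simp
  ring

theorem integral_sq_mul_truncExp {t : ℝ} (ht : 0 < t) :
    ∫ y in (0 : ℝ)..1, y ^ 2 * truncExp t y = (2 - t * bose t - 2 * bose t) / t ^ 2 := by
  have hq : 0 < 1 - Real.exp (-t) := by simpa using ht
  have h : ∀ y ∈ Set.uIcc (0 : ℝ) 1,
      HasDerivAt (fun y => -(1 / (1 - Real.exp (-t))) *
        ((y ^ 2 + 2 / t * y + 2 / t ^ 2) * Real.exp (-(t * y))))
        (y ^ 2 * truncExp t y) y := by
    intro y _
    have := ((((hasDerivAt_pow 2 y).add ((hasDerivAt_id y).const_mul (2 / t))).add_const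
      (2 / t ^ 2)).mul
      ((hasDerivAt_id y).const_mul t).neg.exp).const_mul (-(1 / (1 - Real.exp (-t))))
    refine this.congr_deriv ?_
    simp [truncExp]
    field_simp
    ring
  rw [intervalIntegral.integral_eq_sub_of_hasDerivAt h
    (Continuous.intervalIntegrable (by fun_prop) _ _), bose_eq]
  simp
  field_simp
  ring

/-- Scaling by tʲ makes the bound uniform in t: for t ≤ 1 both factors are at most 1, and for t > 1
the normalizer 1 - e^{-t} is at least 1/2 and the Gamma integral applies. -/
theorem pow_mul_integral_pow_mul_truncExp_le (j : ℕ) {t : ℝ} (ht : 0 < t) :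
    t ^ j * ∫ y in (0 : ℝ)..1, y ^ j * truncExp t y ≤ 2 * j.factorial := by
  have hq : 0 < 1 - Real.exp (-t) := by simpa using ht
  have hj : (1 : ℝ) ≤ j.factorial := by exact_mod_cast Nat.succ_le_of_lt j.factorial_pos
  rcases le_or_gt t 1 with h | h
  · have h1 : ∫ y in (0 : ℝ)..1, y ^ j * truncExp t y ≤ 1 := by
      have c1 : Continuous fun y : ℝ => y ^ j * truncExp t y := by fun_prop
      refine (intervalIntegral.integral_mono_on zero_le_one (c1.intervalIntegrable _ _)
        ((continuous_truncExp t).intervalIntegrable _ _) fun y hy => ?_).trans_eq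
        (integral_truncExp ht)
      exact mul_le_of_le_one_left (truncExp_nonneg ht y) (pow_le_one₀ hy.1 hy.2)
    have h0 : 0 ≤ ∫ y in (0 : ℝ)..1, y ^ j * truncExp t y :=
      intervalIntegral.integral_nonneg zero_le_one fun y hy =>
        mul_nonneg (pow_nonneg hy.1 j) (truncExp_nonneg ht y)
    have h2 : t ^ j ≤ 1 := pow_le_one₀ ht.le h
    have := mul_le_mul h2 h1 h0 zero_le_one
    linarith
  · have h1 : ∫ y in (0 : ℝ)..1, y ^ j * Real.exp (-(t * y)) ≤ j.factorial / t ^ (j + 1) := by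
      rw [← integral_pow_mul_exp_neg_mul j ht, intervalIntegral.integral_of_le zero_le_one]
      refine setIntegral_mono_set (integrableOn_pow_mul_exp_neg_mul j ht) ?_
        (Eventually.of_forall Set.Ioc_subset_Ioi_self)
      filter_upwards [ae_restrict_mem measurableSet_Ioi] with y hy
      exact mul_nonneg (pow_nonneg (le_of_lt hy) j) (Real.exp_pos _).le
    have e : ∫ y in (0 : ℝ)..1, y ^ j * truncExp t y =
        t / (1 - Real.exp (-t)) * ∫ y in (0 : ℝ)..1, y ^ j * Real.exp (-(t * y)) := by
      rw [← intervalIntegral.integral_const_mul]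
      congr 1 with y
      rw [truncExp]
      ring
    have hq2 : 1 / 2 ≤ 1 - Real.exp (-t) := by
      have h2 : Real.exp (-t) ≤ 1 / 2 := by
        rw [Real.exp_neg, ← one_div]
        exact one_div_le_one_div_of_le two_pos (by linarith [Real.add_one_le_exp t])
      linarith
    calc t ^ j * ∫ y in (0 : ℝ)..1, y ^ j * truncExp t y
        ≤ t ^ j * (t / (1 - Real.exp (-t)) * (j.factorial / t ^ (j + 1))) := by
          rw [e]
          gcongr
      _ = j.factorial / (1 - Real.exp (-t)) := by rw [pow_succ]; field_simp
      _ ≤ j.factorial / (1 / 2) := by gcongr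
      _ = 2 * j.factorial := by ring

/-- The second moment of a sum of independent variables, for a product density on the cube. -/
theorem integral_sq_sum_sub_mul_prod (n : ℕ) {ρ f : ℝ → ℝ} (hρ : Continuous ρ)
    (hf : Continuous f) {m v : ℝ} (h1 : ∫ x in (0 : ℝ)..1, ρ x = 1)
    (hm : ∫ x in (0 : ℝ)..1, f x * ρ x = m) (hv : ∫ x in (0 : ℝ)..1, f x ^ 2 * ρ x = v) :
    ∫ y, ((∑ j, f (y j)) - n * m) ^ 2 * ∏ i, ρ (y i) ∂cube n = n * (v - m ^ 2) := by
  classical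
  set g : ℝ → ℝ := fun x => f x - m with hg
  have gc : Continuous g := by fun_prop
  have hg1 : ∫ x in (0 : ℝ)..1, g x * ρ x = 0 := by
    simp only [hg, sub_mul]
    rw [intervalIntegral.integral_sub (Continuous.intervalIntegrable (by fun_prop) _ _)
      (Continuous.intervalIntegrable (by fun_prop) _ _), intervalIntegral.integral_const_mul,
      hm, h1]
    ring
  have hg2 : ∫ x in (0 : ℝ)..1, g x * g x * ρ x = v - m ^ 2 := by
    have e : (fun x => g x * g x * ρ x) = fun x =>
        f x ^ 2 * ρ x - 2 * m * (f x * ρ x) + m ^ 2 * ρ x := by funext x; simp only [hg]; ring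
    rw [e, intervalIntegral.integral_add (Continuous.intervalIntegrable (by fun_prop) _ _)
      (Continuous.intervalIntegrable (by fun_prop) _ _),
      intervalIntegral.integral_sub (Continuous.intervalIntegrable (by fun_prop) _ _)
      (Continuous.intervalIntegrable (by fun_prop) _ _), intervalIntegral.integral_const_mul,
      intervalIntegral.integral_const_mul, hv, hm, h1]
    ring
  -- The square becomes a double sum of products over coordinates; off the diagonal a centred factor
  -- integrates to zero.
  have expand : ∀ y : Fin n → ℝ, ((∑ j, f (y j)) - n * m) ^ 2 * ∏ i, ρ (y i) =
      ∑ j, ∑ k, ∏ i, ((if i = j then g (y i) else 1) * (if i = k then g (y i) else 1) *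
        ρ (y i)) := by
    intro y
    have : (∑ j, f (y j)) - n * m = ∑ j, g (y j) := by simp [hg]
    rw [this, sq, Finset.sum_mul_sum, Finset.sum_mul]
    refine Finset.sum_congr rfl fun j _ => ?_
    rw [Finset.sum_mul]
    refine Finset.sum_congr rfl fun k _ => ?_
    rw [Finset.prod_mul_distrib, Finset.prod_mul_distrib]
    simp
  simp only [expand]
  have ic : ∀ j k : Fin n, Integrable (fun y : Fin n → ℝ => ∏ i, ((if i = j then g (y i) else 1) *
      (if i = k then g (y i) else 1) * ρ (y i))) (cube n) := by
    intro j k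
    refine integrable_cube_of_continuous (continuous_finsetProd _ fun i _ => ?_)
    split_ifs <;> fun_prop
  rw [integral_finsetSum _ fun j _ => integrable_finsetSum _ fun k _ => ic j k]
  have row : ∀ j : Fin n, ∫ y, ∑ k, ∏ i, ((if i = j then g (y i) else 1) *
      (if i = k then g (y i) else 1) * ρ (y i)) ∂cube n = v - m ^ 2 := by
    intro j
    rw [integral_finsetSum _ fun k _ => ic j k, Finset.sum_eq_single j]
    · rw [integral_cube_prod fun i x => (if i = j then g x else 1) * (if i = j then g x else 1) *
        ρ x, Finset.prod_eq_single j]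
      · simpa using hg2
      · intro i _ hi
        simpa [hi] using h1
      · simp
    · intro k _ hk
      rw [integral_cube_prod fun i x => (if i = j then g x else 1) * (if i = k then g x else 1) *
        ρ x]
      refine Finset.prod_eq_zero (Finset.mem_univ j) ?_
      simpa [hk.symm] using hg1
    · simp
  rw [Finset.sum_congr rfl fun j _ => row j]
  simp [mul_sub]

/-- The joint density of `n` independent truncated exponential variables of rate `t`. -/
noncomputable def truncExpProd {n : ℕ} (t : ℝ) (y : Fin n → ℝ) : ℝ := ∏ i, truncExp t (y i)

theorem continuous_truncExpProd {n : ℕ} (t : ℝ) :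
    Continuous (truncExpProd t : (Fin n → ℝ) → ℝ) := by
  unfold truncExpProd
  fun_prop

theorem truncExpProd_nonneg {n : ℕ} {t : ℝ} (ht : 0 < t) (y : Fin n → ℝ) :
    0 ≤ truncExpProd t y :=
  Finset.prod_nonneg fun i _ => truncExp_nonneg ht (y i)

theorem integral_truncExpProd (n : ℕ) {t : ℝ} (ht : 0 < t) :
    ∫ y, truncExpProd t y ∂cube n = 1 := by
  simp only [truncExpProd]
  rw [integral_cube_prod fun _ => truncExp t]
  simp [integral_truncExp ht]

theorem integral_sq_mean_deviation_le {n : ℕ} (hn : 1 ≤ n) (j : ℕ) {t c : ℝ} (ht : 0 < t)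
    (hc : t ^ j * ∫ x in (0 : ℝ)..1, x ^ j * truncExp t x = c) :
    ∫ y, (t ^ j * (∑ i, y i ^ j) / n - c) ^ 2 * truncExpProd t y ∂cube n ≤
      2 * (2 * j).factorial / n := by
  have hn0 : (0 : ℝ) < n := by exact_mod_cast hn
  have h := integral_sq_sum_sub_mul_prod n (continuous_truncExp t)
    (by fun_prop : Continuous fun x : ℝ => x ^ j) (integral_truncExp ht) rfl rfl
  set m := ∫ x in (0 : ℝ)..1, x ^ j * truncExp t x
  have e : ∀ y : Fin n → ℝ, (t ^ j * (∑ i, y i ^ j) / n - c) ^ 2 * truncExpProd t y =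
      (t ^ j / n) ^ 2 * (((∑ i, y i ^ j) - n * m) ^ 2 * ∏ i, truncExp t (y i)) := by
    intro y
    rw [← hc, truncExpProd]
    field_simp
  simp only [e]
  rw [integral_const_mul, h]
  have hv := pow_mul_integral_pow_mul_truncExp_le (2 * j) ht
  have e2 : ∀ x : ℝ, (x ^ j) ^ 2 = x ^ (2 * j) := fun x => by rw [← pow_mul, mul_comm]
  simp only [e2]
  have e3 : (t ^ j / n) ^ 2 * (n * ((∫ x in (0 : ℝ)..1, x ^ (2 * j) * truncExp t x) - m ^ 2)) =
      (t ^ (2 * j) * (∫ x in (0 : ℝ)..1, x ^ (2 * j) * truncExp t x) - (t ^ j * m) ^ 2) / n := by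
    rw [← e2]
    field_simp
  rw [e3]
  gcongr
  nlinarith [sq_nonneg (t ^ j * m)]

/-! ### Comparison of the correction with its limiting value. -/

theorem abs_exp_sub_exp_le {z a : ℝ} {M : ℝ} (hz : Real.exp z ≤ M) (ha : Real.exp a ≤ M) :
    |Real.exp z - Real.exp a| ≤ M * |z - a| := by
  have h1 := Real.add_one_le_exp (a - z)
  have h2 := Real.add_one_le_exp (z - a)
  have e1 : Real.exp a = Real.exp z * Real.exp (a - z) := by rw [← Real.exp_add]; ring_nf
  have e2 : Real.exp z = Real.exp a * Real.exp (z - a) := by rw [← Real.exp_add]; ring_nf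
  have p1 := Real.exp_pos z
  have p2 := Real.exp_pos a
  have k1 : Real.exp z - Real.exp a ≤ Real.exp z * (z - a) := by nlinarith
  have k2 : Real.exp a - Real.exp z ≤ Real.exp a * (a - z) := by nlinarith
  have q0 := abs_nonneg (z - a)
  have q1 : Real.exp z * (z - a) ≤ M * |z - a| := by nlinarith [le_abs_self (z - a)]
  have q2 : Real.exp a * (a - z) ≤ M * |z - a| := by nlinarith [neg_abs_le (z - a)]
  rw [abs_le]
  constructor <;> linarith

theorem abs_one_div_sub_one_le {r : ℝ} (hr : 1 / 2 ≤ r) : |1 / r - 1| ≤ 2 * |r - 1| := by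
  have hrp : 0 < r := by linarith
  have e : 1 / r - 1 = -(r - 1) / r := by field_simp; ring
  rw [e, abs_div, abs_neg, abs_of_pos hrp, div_le_iff₀ hrp]
  nlinarith [abs_nonneg (r - 1)]

/-- Since e^s - 1 = n/d. This identity ties the deterministic part d of U to the same function that
governs the mean of the thresholds. -/
theorem bose_log_eq {n d : ℕ} (hd : 1 ≤ d) {s : ℝ} (hs : s = Real.log ((d + n) / d)) :
    bose s = s * d / n := by
  have hd0 : (0 : ℝ) < d := by exact_mod_cast hd
  have e : ((d : ℝ) + n) / d - 1 = n / d := by field_simp; ring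
  rw [bose, hs, Real.exp_log (by positivity), e, div_div_eq_mul_div]

theorem exp_two_le : Real.exp 2 ≤ 8 := by
  have : Real.exp 2 = Real.exp 1 ^ 2 := by rw [← Real.exp_nat_mul]; norm_num
  rw [this]
  nlinarith [Real.exp_one_lt_d9, Real.exp_pos 1]

/-- The comparison of the main quantities, in scale-free variables. -/
theorem abs_main_exponent_sub_le {r g g' k k' e₁ e₂ P β : ℝ} (hD : |r - 1| + |e₁| ≤ 1 / 12)
    (hg0 : 0 ≤ g) (hg1 : g ≤ 1) (hk0 : 0 ≤ k) (hk1 : k ≤ 1)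
    (hgg : |g' - g| ≤ 4 * |r - 1|) (hkk : |k' - k| ≤ 14 * |r - 1|)
    (hP : P = g / r + (1 - g' + e₁)) (hβ : β = k / r ^ 2 + (2 - k' - 2 * g' + e₂)) :
    |P - 1| ≤ 1 / 2 ∧
    |1 - g / r / P - β / P ^ 2 - (g - 1)| ≤ 248 * (|r - 1| + |e₁| + |e₂|) := by
  have hρ := abs_nonneg (r - 1)
  have he1 := abs_nonneg e₁
  have he2 := abs_nonneg e₂
  have hr : |r - 1| ≤ 1 / 12 := by linarith
  set ρ := |r - 1| with hρdef
  have hr0 : 1 / 2 ≤ r := by linarith [(abs_le.1 hr).1]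
  have hrp : 0 < r := by linarith
  have hinv : |1 / r - 1| ≤ 2 * ρ := abs_one_div_sub_one_le hr0
  have hinv2 : |1 / r ^ 2 - 1| ≤ 6 * ρ := by
    have e : 1 / r ^ 2 - 1 = (1 / r - 1) * (1 / r + 1) := by ring
    have h3 : |1 / r + 1| ≤ 3 := by
      have : 1 / r ≤ 2 := by rw [div_le_iff₀ hrp]; linarith
      rw [abs_of_pos (by positivity)]
      linarith
    rw [e, abs_mul]
    calc |1 / r - 1| * |1 / r + 1| ≤ 2 * ρ * 3 := by gcongr
      _ = 6 * ρ := by ring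
  have hα : |g / r - g| ≤ 2 * ρ := by
    have e : g / r - g = g * (1 / r - 1) := by ring
    rw [e, abs_mul, abs_of_nonneg hg0]
    exact (mul_le_of_le_one_left (abs_nonneg _) hg1).trans hinv
  have hκ : |k / r ^ 2 - k| ≤ 6 * ρ := by
    have e : k / r ^ 2 - k = k * (1 / r ^ 2 - 1) := by ring
    rw [e, abs_mul, abs_of_nonneg hk0]
    exact (mul_le_of_le_one_left (abs_nonneg _) hk1).trans hinv2
  -- At r = 1 with unperturbed arguments, P = 1 and β = 2 - 2g, so the exponent is 1 - g - (2-2g) =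
  -- g - 1; the rest measures departures from this point.
  have hPD : |P - 1| ≤ 6 * ρ + |e₁| := by
    have e : P - 1 = (g / r - g) - (g' - g) + e₁ := by rw [hP]; ring
    rw [e]
    have := abs_add_le ((g / r - g) - (g' - g)) e₁
    have := abs_sub (g / r - g) (g' - g)
    linarith
  have hβD : |β - (2 - 2 * g)| ≤ 28 * ρ + |e₂| := by
    have e : β - (2 - 2 * g) = (k / r ^ 2 - k) - (k' - k) - 2 * (g' - g) + e₂ := by
      rw [hβ]; ring
    rw [e]
    have h1 := abs_add_le ((k / r ^ 2 - k) - (k' - k) - 2 * (g' - g)) e₂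
    have h2 := abs_sub ((k / r ^ 2 - k) - (k' - k)) (2 * (g' - g))
    have h3 := abs_sub (k / r ^ 2 - k) (k' - k)
    have h4 : |2 * (g' - g)| = 2 * |g' - g| := by rw [abs_mul, abs_two]
    linarith
  have hPl : |P - 1| ≤ 1 / 2 := by linarith
  refine ⟨hPl, ?_⟩
  obtain ⟨hP1, hP2⟩ := abs_le.1 hPl
  have hPp : 1 / 2 ≤ P := by linarith
  have hPpos : 0 < P := by linarith
  have hx : |g / r / P - g| ≤ 2 * (2 * ρ + (6 * ρ + |e₁|)) := by
    have e : g / r / P - g = ((g / r - g) - g * (P - 1)) / P := by field_simp; ring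
    rw [e, abs_div, abs_of_pos hPpos, div_le_iff₀ hPpos]
    have h1 := abs_sub (g / r - g) (g * (P - 1))
    have h2 : |g * (P - 1)| ≤ 6 * ρ + |e₁| := by
      rw [abs_mul, abs_of_nonneg hg0]
      exact (mul_le_of_le_one_left (abs_nonneg _) hg1).trans hPD
    have h3 : 0 ≤ 2 * ρ + (6 * ρ + |e₁|) := by positivity
    have h4 := mul_le_mul_of_nonneg_left hPp h3
    linarith
  have hy : |β / P ^ 2 - (2 - 2 * g)| ≤ 4 * (28 * ρ + |e₂| + 5 * (6 * ρ + |e₁|)) := by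
    have e : β / P ^ 2 - (2 - 2 * g) =
        ((β - (2 - 2 * g)) - (2 - 2 * g) * ((P - 1) * (P + 1))) / P ^ 2 := by field_simp; ring
    have hP4 : 1 / 4 ≤ P ^ 2 := by nlinarith
    rw [e, abs_div, abs_of_pos (by positivity : 0 < P ^ 2), div_le_iff₀ (by positivity)]
    have h1 := abs_sub (β - (2 - 2 * g)) ((2 - 2 * g) * ((P - 1) * (P + 1)))
    have h2 : |(2 - 2 * g) * ((P - 1) * (P + 1))| ≤ 5 * (6 * ρ + |e₁|) := by
      rw [abs_mul, abs_mul, abs_of_nonneg (by linarith : 0 ≤ 2 - 2 * g),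
        abs_of_nonneg (by linarith : 0 ≤ P + 1)]
      calc (2 - 2 * g) * (|P - 1| * (P + 1)) ≤ 2 * ((6 * ρ + |e₁|) * 2.5) := by
            gcongr <;> linarith
        _ = _ := by ring
    have h3 : 0 ≤ 28 * ρ + |e₂| + 5 * (6 * ρ + |e₁|) := by positivity
    have h4 := mul_le_mul_of_nonneg_left hP4 h3
    linarith
  -- The constant is the coefficient of |r - 1|: 2·8 + 4·(28 + 30) = 248.
  have e : 1 - g / r / P - β / P ^ 2 - (g - 1) =
      -((g / r / P - g) + (β / P ^ 2 - (2 - 2 * g))) := by ring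
  rw [e, abs_neg]
  have := abs_add_le (g / r / P - g) (β / P ^ 2 - (2 - 2 * g))
  linarith

theorem abs_correction_sub_le {n d : ℕ} (hn : 1 ≤ n) (hd : 1 ≤ d) {s t : ℝ} (ht : 0 < t)
    (hs : s = Real.log ((d + n) / d)) {y : Fin n → ℝ} (h0 : ∀ i, 0 ≤ y i) (h1 : ∀ i, y i ≤ 1)
    {e₁ e₂ : ℝ} (he₁ : e₁ = t ^ 1 * (∑ i, y i ^ 1) / n - (1 - bose t))
    (he₂ : e₂ = t ^ 2 * (∑ i, y i ^ 2) / n - (2 - t * bose t - 2 * bose t)) :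
    |correction d y - Real.exp (bose s - 1)| ≤
      300000 * (|s / t - 1| + |e₁| + |e₂| + s ^ 2 / n) := by
  have hn0 : (0 : ℝ) < n := by exact_mod_cast hn
  have hd0 : (0 : ℝ) < d := by exact_mod_cast hd
  have hspos : 0 < s := hs ▸ Real.log_pos (by rw [one_lt_div hd0]; linarith)
  have hc0 := correction_nonneg (d := d) h0 h1
  have hc8 : correction d y ≤ 8 := (correction_le hd h0 h1).trans exp_two_le
  have hg0 := bose_nonneg hspos
  have hg1 := bose_le_one hspos
  have ha1 : Real.exp (bose s - 1) ≤ 1 := Real.exp_le_one_iff.2 (by linarith)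
  have ha0 := Real.exp_pos (bose s - 1)
  have hρ := abs_nonneg (s / t - 1)
  have ha_1 := abs_nonneg e₁
  have ha_2 := abs_nonneg e₂
  have hL : 0 ≤ s ^ 2 / n := by positivity
  have htriv : |correction d y - Real.exp (bose s - 1)| ≤ 8 := by
    rw [abs_le]; constructor <;> linarith
  -- Outside the small-error regime the trivial bound 8 is enough, since 300000/30000 = 10.
  by_cases hbig : 1 / 30000 ≤ |s / t - 1| + |e₁| + |e₂| + s ^ 2 / n
  · linarith
  push Not at hbig
  set r := s / t with hr
  have hrp : 0 < r := div_pos hspos ht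
  set T := ∑ j, y j with hT
  set T2 := ∑ j, y j ^ 2 with hT2
  simp only [pow_one] at he₁
  have hbs := bose_log_eq hd hs
  set P := t * (d + T) / n with hPdef
  set β := t ^ 2 * (d + T2) / n with hβdef
  have hP : P = bose s / r + (1 - bose t + e₁) := by
    rw [he₁, hbs, hr, hPdef]; field_simp; ring
  have hβ : β = s * bose s / r ^ 2 + (2 - t * bose t - 2 * bose t + e₂) := by
    rw [he₂, hbs, hr, hβdef]; field_simp; ring
  have hD : |r - 1| + |e₁| ≤ 1 / 12 := by linarith
  obtain ⟨hPl, hmain⟩ := abs_main_exponent_sub_le hD hg0 hg1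
    (mul_nonneg hspos.le hg0) (mul_bose_le_one hspos) (abs_bose_sub_le hspos ht)
    (abs_mul_bose_sub_le hspos ht) hP hβ
  obtain ⟨hPl1, hPl2⟩ := abs_le.1 hPl
  have hPpos : 0 < P := by linarith
  have hts : t ≤ 2 * s := by
    have : 1 / 2 ≤ r := by linarith [neg_abs_le (r - 1)]
    rw [hr, le_div_iff₀ ht] at this
    linarith
  have hUP : (d : ℝ) + T = n * P / t := by rw [hPdef]; field_simp
  have hU40 : 40 ≤ (d : ℝ) + T := by
    -- With t ≤ 2s and P ≥ 1/2, U = nP/t ≥ n/(4s), so U ≥ 40 follows from n ≥ 160s; and 160² ≤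
    -- 30000.
    have hs160 : 160 * s ≤ n := by
      have h2 : s ^ 2 / n ≤ 1 / 30000 := by linarith
      rw [div_le_div_iff₀ hn0 (by norm_num)] at h2
      have hn1 : (1 : ℝ) ≤ n := by exact_mod_cast hn
      have hnn : (n : ℝ) ≤ n ^ 2 := le_self_pow₀ hn1 two_ne_zero
      have hs0 := sq_nonneg s
      refine (sq_le_sq₀ (by positivity) hn0.le).1 ?_
      rw [mul_pow]
      linarith
    rw [hUP, le_div_iff₀ ht]
    have := mul_le_mul_of_nonneg_left (by linarith : 1 / 2 ≤ P) hn0.le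
    linarith
  have hnU : n / ((d : ℝ) + T) ^ 2 ≤ 16 * (s ^ 2 / n) := by
    have e : n / ((d : ℝ) + T) ^ 2 = t ^ 2 / n / P ^ 2 := by rw [hUP]; field_simp
    have h4 : t ^ 2 ≤ 4 * s ^ 2 := (pow_le_pow_left₀ ht.le hts 2).trans_eq (by ring)
    have hP4 : 1 / 4 ≤ P ^ 2 :=
      le_trans (by norm_num) (pow_le_pow_left₀ (by norm_num) (by linarith : 1 / 2 ≤ P) 2)
    rw [e]
    calc t ^ 2 / n / P ^ 2 ≤ 4 * s ^ 2 / n / (1 / 4) := by gcongr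
      _ = _ := by ring
  have hlc : logCorrection d y = 1 - bose s / r / P - β / P ^ 2 := by
    have e1 : bose s / r / P = d / (d + T) := by
      rw [hbs, hr, hPdef]; field_simp
    have e2 : β / P ^ 2 = n * (d + T2) / (d + T) ^ 2 := by
      rw [hβdef, hPdef]; field_simp
    have e3 : T / (d + T) = 1 - d / (d + T) := by
      have : (d : ℝ) + T ≠ 0 := by linarith
      field_simp; ring
    rw [logCorrection, ← hT, ← hT2, e1, e2, e3]
  obtain ⟨hb1, hb2⟩ := correction_bounds h0 h1 hU40
  have hcpos : 0 < correction d y := (Real.exp_pos _).trans_le hb1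
  rw [← Real.le_log_iff_exp_le hcpos] at hb1
  rw [← Real.log_le_iff_le_exp hcpos] at hb2
  have hz : |Real.log (correction d y) - (bose s - 1)| ≤
      248 * (|r - 1| + |e₁| + |e₂|) + 240 * (s ^ 2 / n) := by
    rw [← hlc] at hmain
    obtain ⟨m1, m2⟩ := abs_le.1 hmain
    rw [abs_le]
    constructor <;> linarith
  have := abs_exp_sub_exp_le (z := Real.log (correction d y)) (a := bose s - 1) (M := 8)
    (by rwa [Real.exp_log hcpos]) (by linarith)
  rw [Real.exp_log hcpos] at this
  linarith

theorem continuous_manFactor {n : ℕ} (d : ℕ) (m : Fin n) :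
    Continuous fun y : Fin n → ℝ => manFactor d y m := by
  unfold manFactor
  exact intervalIntegral.continuous_parametric_intervalIntegral_of_continuous' (by fun_prop) 0 1

theorem continuous_correction {n : ℕ} (d : ℕ) :
    Continuous fun y : Fin n → ℝ => correction d y := by
  have := fun m : Fin n => continuous_manFactor d m
  unfold correction
  fun_prop

theorem ae_cube_mem (n : ℕ) : ∀ᵐ y ∂cube n, (∀ i, 0 ≤ y i) ∧ ∀ i, y i ≤ 1 := by
  rw [cube_eq_restrict]
  filter_upwards [ae_restrict_mem (MeasurableSet.univ_pi fun _ => measurableSet_Ioc)] with y hy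
  exact ⟨fun i => (hy i trivial).1.le, fun i => (hy i trivial).2⟩

/-- The mean of `correction` for independent truncated exponential thresholds of rate `t`. -/
noncomputable def meanCorrection (n d : ℕ) (t : ℝ) : ℝ :=
  ∫ y : Fin n → ℝ, correction d y * truncExpProd t y ∂cube n

theorem integrable_correction_mul (n d : ℕ) (t : ℝ) :
    Integrable (fun y : Fin n → ℝ => correction d y * truncExpProd t y) (cube n) :=
  integrable_cube_of_continuous ((continuous_correction d).mul (continuous_truncExpProd t))

theorem abs_meanCorrection_le (n : ℕ) {d : ℕ} (hd : 1 ≤ d) {t : ℝ} (ht : 0 < t) :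
    |meanCorrection n d t| ≤ Real.exp 2 := by
  have h : ∀ᵐ y ∂cube n, ‖correction d y * truncExpProd t y‖ ≤ Real.exp 2 * truncExpProd t y := by
    filter_upwards [ae_cube_mem n] with y hy
    rw [Real.norm_of_nonneg (mul_nonneg (correction_nonneg hy.1 hy.2) (truncExpProd_nonneg ht y))]
    exact mul_le_mul_of_nonneg_right (correction_le hd hy.1 hy.2) (truncExpProd_nonneg ht y)
  have := norm_integral_le_of_norm_le
    ((integrable_cube_of_continuous (continuous_truncExpProd t)).const_mul (Real.exp 2)) h
  rwa [integral_const_mul, integral_truncExpProd n ht, mul_one] at this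

theorem abs_meanCorrection_sub_le {n d : ℕ} (hn : 1 ≤ n) (hd : 1 ≤ d) {s t : ℝ} (ht : 0 < t)
    (hs : s = Real.log ((d + n) / d)) :
    |meanCorrection n d t - Real.exp (bose s - 1)| ≤
      300000 * (|s / t - 1| + 27 / √n + s ^ 2 / n) := by
  have hn0 : (0 : ℝ) < n := by exact_mod_cast hn
  have hq : 0 < √(n : ℝ) := Real.sqrt_pos.2 hn0
  have hqq : √(n : ℝ) * √(n : ℝ) = n := Real.mul_self_sqrt hn0.le
  have c1 : t ^ 1 * ∫ x in (0 : ℝ)..1, x ^ 1 * truncExp t x = 1 - bose t := by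
    simp only [pow_one, integral_id_mul_truncExp ht]
    field_simp
  have c2 : t ^ 2 * ∫ x in (0 : ℝ)..1, x ^ 2 * truncExp t x = 2 - t * bose t - 2 * bose t := by
    rw [integral_sq_mul_truncExp ht]
    field_simp
  have v1 := integral_sq_mean_deviation_le hn 1 ht c1
  have v2 := integral_sq_mean_deviation_le hn 2 ht c2
  norm_num [Nat.factorial] at v1 v2
  set e₁ : (Fin n → ℝ) → ℝ := fun y => t ^ 1 * (∑ i, y i ^ 1) / n - (1 - bose t) with he₁
  set e₂ : (Fin n → ℝ) → ℝ := fun y => t ^ 2 * (∑ i, y i ^ 2) / n -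
    (2 - t * bose t - 2 * bose t) with he₂
  have ce₁ : Continuous e₁ := by fun_prop
  have ce₂ : Continuous e₂ := by fun_prop
  have cρ := continuous_truncExpProd (n := n) t
  have i0 := integrable_cube_of_continuous cρ
  have i1 : Integrable (fun y => e₁ y ^ 2 * truncExpProd t y) (cube n) :=
    integrable_cube_of_continuous (by fun_prop)
  have i2 : Integrable (fun y => e₂ y ^ 2 * truncExpProd t y) (cube n) :=
    integrable_cube_of_continuous (by fun_prop)
  have v1' : ∫ y, e₁ y ^ 2 * truncExpProd t y ∂cube n ≤ 4 / n := by
    simpa only [he₁, pow_one] using v1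
  have v2' : ∫ y, e₂ y ^ 2 * truncExpProd t y ∂cube n ≤ 48 / n := v2
  set D := |s / t - 1| + s ^ 2 / n + 1 / √n with hD
  -- Converts the variances 4/n and 48/n into first-order errors; the final 27 is 1 + 4/2 + 48/2.
  have amgm : ∀ e : ℝ, |e| ≤ (1 / √n + √n * e ^ 2) / 2 := by
    intro e
    have : 0 ≤ √n * (|e| - 1 / √n) ^ 2 := by positivity
    have h2 : √n * (|e| - 1 / √n) ^ 2 = √n * e ^ 2 - 2 * |e| + 1 / √n := by
      rw [sub_sq, sq_abs]
      field_simp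
    linarith
  have hpt : ∀ᵐ y ∂cube n,
      ‖correction d y * truncExpProd t y - Real.exp (bose s - 1) * truncExpProd t y‖ ≤
      300000 * (D * truncExpProd t y + √n / 2 * (e₁ y ^ 2 * truncExpProd t y) +
        √n / 2 * (e₂ y ^ 2 * truncExpProd t y)) := by
    filter_upwards [ae_cube_mem n] with y hy
    have hρ := truncExpProd_nonneg ht y
    have h := abs_correction_sub_le hn hd ht hs hy.1 hy.2 (rfl : e₁ y = _) (rfl : e₂ y = _)
    have a1 := amgm (e₁ y)
    have a2 := amgm (e₂ y)
    rw [← sub_mul, norm_mul, Real.norm_of_nonneg hρ, Real.norm_eq_abs]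
    have h' : |correction d y - Real.exp (bose s - 1)| ≤
        300000 * (D + √n / 2 * e₁ y ^ 2 + √n / 2 * e₂ y ^ 2) := by
      rw [hD]
      linarith
    refine (mul_le_mul_of_nonneg_right h' hρ).trans (le_of_eq (by ring))
  have i01 : Integrable (fun y => D * truncExpProd t y + √n / 2 * (e₁ y ^ 2 * truncExpProd t y))
    (cube n) := (i0.const_mul _).add (i1.const_mul _)
  have hmain := norm_integral_le_of_norm_le ((i01.add (i2.const_mul (√n / 2))).const_mul 300000) hpt
  simp only [Pi.add_apply] at hmain
  rw [integral_sub (integrable_correction_mul n d t) (i0.const_mul _), integral_const_mul,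
    integral_const_mul, integral_truncExpProd n ht, integral_add i01 (i2.const_mul _),
    integral_add (i0.const_mul _) (i1.const_mul _), integral_const_mul, integral_const_mul,
    integral_const_mul, integral_truncExpProd n ht, Real.norm_eq_abs, mul_one, mul_one] at hmain
  refine hmain.trans (mul_le_mul_of_nonneg_left ?_ (by norm_num))
  have hdiv : ∀ c : ℝ, √n / 2 * (c / n) = c / 2 / √n := fun c => by
    have e : √(n : ℝ) / 2 * (c / n) * √n = √n * √n * c / (2 * n) := by ring
    rw [eq_div_iff hq.ne', e, hqq]
    field_simp
  have w1 : √n / 2 * ∫ y, e₁ y ^ 2 * truncExpProd t y ∂cube n ≤ 2 / √n := by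
    calc _ ≤ √n / 2 * (4 / n) := by gcongr
      _ = 2 / √n := by rw [hdiv]; norm_num
  have w2 : √n / 2 * ∫ y, e₂ y ^ 2 * truncExpProd t y ∂cube n ≤ 24 / √n := by
    calc _ ≤ √n / 2 * (48 / n) := by gcongr
      _ = 24 / √n := by rw [hdiv]; norm_num
  have e : 27 / √(n : ℝ) = 1 / √n + 2 / √n + 24 / √n := by ring
  rw [hD, e]
  linarith

/-! ### Gamma representation and the quantitative estimate. -/

/-- U⁻ⁿ = (1/(n-1)!) ∫ t^{n-1} e^{-Ut} dt, followed by Fubini. For fixed t, e^{-t∑y} is the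
truncated exponential density times ((1-e^{-t})/t)ⁿ, which leaves the beta weight and one factor
1/t. -/
theorem integral_prod_manFactor {n d : ℕ} (hn : 1 ≤ n) (hd : 1 ≤ d) :
    IntegrableOn (fun t => 1 / t * betaWeight d n t * meanCorrection n d t) (Set.Ioi 0) ∧
    ∫ y, ∏ m, manFactor d y m ∂cube n = 1 / ((n - 1).factorial : ℝ) *
      ∫ t in Set.Ioi (0 : ℝ), 1 / t * betaWeight d n t * meanCorrection n d t := by
  have hd0 : (0 : ℝ) < d := by exact_mod_cast hd
  set F : (Fin n → ℝ) → ℝ → ℝ := fun y t =>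
    correction d y * (t ^ (n - 1) * Real.exp (-((d + ∑ j, y j) * t))) with hF
  have cF : Continuous (Function.uncurry F) := by
    have := continuous_correction (n := n) d
    simp only [hF, Function.uncurry_def]
    fun_prop
  have hmeas : (cube n).prod (volume.restrict (Set.Ioi (0 : ℝ))) =
      (volume.prod volume).restrict
        ((Set.univ.pi fun _ => Set.Ioc (0 : ℝ) 1) ×ˢ Set.Ioi (0 : ℝ)) := by
    rw [cube_eq_restrict, Measure.prod_restrict]
  have intF : Integrable (Function.uncurry F)
      ((cube n).prod (volume.restrict (Set.Ioi (0 : ℝ)))) := by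
    have hdom : Integrable (fun z : (Fin n → ℝ) × ℝ => Real.exp 2 *
        (z.2 ^ (n - 1) * Real.exp (-(d * z.2))))
        ((cube n).prod (volume.restrict (Set.Ioi (0 : ℝ)))) :=
      (integrable_cube_of_continuous (continuous_const (y := Real.exp 2))).mul_prod
        (integrableOn_pow_mul_exp_neg_mul (n - 1) hd0)
    refine hdom.mono' cF.aestronglyMeasurable ?_
    rw [hmeas]
    filter_upwards [ae_restrict_mem ((MeasurableSet.univ_pi fun _ => measurableSet_Ioc).prod
      measurableSet_Ioi)] with z hz
    have h0 : ∀ i, 0 ≤ z.1 i := fun i => (hz.1 i trivial).1.le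
    have h1 : ∀ i, z.1 i ≤ 1 := fun i => (hz.1 i trivial).2
    have ht : 0 ≤ z.2 := le_of_lt hz.2
    have hsum : 0 ≤ ∑ j, z.1 j := Finset.sum_nonneg fun j _ => h0 j
    have hp : 0 ≤ z.2 ^ (n - 1) * Real.exp (-((d + ∑ j, z.1 j) * z.2)) := by positivity
    simp only [Function.uncurry, hF]
    rw [Real.norm_of_nonneg (mul_nonneg (correction_nonneg h0 h1) hp)]
    refine mul_le_mul (correction_le hd h0 h1) ?_ hp (Real.exp_pos _).le
    gcongr
    linarith
  have inner_t : ∀ t ∈ Set.Ioi (0 : ℝ), ∫ y, F y t ∂cube n =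
      1 / t * betaWeight d n t * meanCorrection n d t := by
    intro t ht
    have ht : 0 < t := ht
    have hq : 0 < 1 - Real.exp (-t) := by simpa using ht
    rw [meanCorrection, ← integral_const_mul]
    congr 1 with y
    have e1 : truncExpProd t y = (t / (1 - Real.exp (-t))) ^ n * Real.exp (-((∑ j, y j) * t)) := by
      simp only [truncExpProd, truncExp]
      rw [Finset.prod_mul_distrib, Finset.prod_const, Finset.card_univ, Fintype.card_fin,
        ← Real.exp_sum, Finset.sum_neg_distrib, ← Finset.mul_sum, mul_comm t]
    have e2 : Real.exp (-((d + ∑ j, y j) * t)) =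
        Real.exp (-(d * t)) * Real.exp (-((∑ j, y j) * t)) := by
      rw [← Real.exp_add]; ring_nf
    have e3 : t ^ (n - 1) = t ^ n / t := by
      rw [eq_div_iff ht.ne', ← pow_succ, Nat.sub_add_cancel hn]
    simp only [hF]
    rw [e1, e2, e3, betaWeight, div_pow]
    field_simp
  have inner_y : ∀ᵐ y ∂cube n, ∫ t in Set.Ioi (0 : ℝ), F y t =
      ((n - 1).factorial : ℝ) * ∏ m, manFactor d y m := by
    filter_upwards [ae_cube_mem n] with y hy
    have hsum : 0 ≤ ∑ j, y j := Finset.sum_nonneg fun j _ => hy.1 j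
    have hU : 0 < (d : ℝ) + ∑ j, y j := by positivity
    simp only [hF]
    rw [integral_const_mul, integral_pow_mul_exp_neg_mul _ hU, Nat.sub_add_cancel hn, correction,
      Finset.prod_mul_distrib, Finset.prod_const, Finset.card_univ, Fintype.card_fin]
    field_simp
  constructor
  · exact (intF.integral_prod_right).congr
      ((ae_restrict_iff' measurableSet_Ioi).2 (Eventually.of_forall inner_t))
  · rw [← setIntegral_congr_fun measurableSet_Ioi inner_t,
      ← integral_integral_swap intF, integral_congr_ae inner_y, integral_const_mul]
    field_simp

/-- The combinatorial constant (d+n)!/(d!(n-1)!) is n/d divided by the mass of the beta weight, and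
multiplying by sd/n turns it into s over that mass. -/
theorem expectedStable_mul_bose {n d : ℕ} (hn : 1 ≤ n) (hd : 1 ≤ d) {s : ℝ}
    (hs : s = Real.log ((d + n) / d)) :
    expectedStable n (n + d) * bose s = 1 / betaMoment 0 d n *
      ∫ t in Set.Ioi (0 : ℝ), s / t * betaWeight d n t * meanCorrection n d t := by
  have hn0 : (0 : ℝ) < n := by exact_mod_cast hn
  have hd0 : (0 : ℝ) < d := by exact_mod_cast hd
  have hbs := bose_log_eq hd hs
  have e : ∀ t : ℝ, s / t * betaWeight d n t * meanCorrection n d t =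
      s * (1 / t * betaWeight d n t * meanCorrection n d t) := fun t => by ring
  simp only [e]
  rw [integral_const_mul, expectedStable_eq_integral, Nat.add_sub_cancel_left,
    (integral_prod_manFactor hn hd).2, hbs]
  obtain ⟨a, rfl⟩ := Nat.exists_eq_add_of_le' hn
  obtain ⟨b, rfl⟩ := Nat.exists_eq_add_of_le' hd
  rw [betaMoment_zero]
  have hdf : (((a + 1 + (b + 1)).descFactorial (a + 1) : ℕ) : ℝ) =
      (b + 1 + (a + 1)).factorial / (b + 1).factorial := by
    rw [eq_div_iff (by positivity), mul_comm]
    have := Nat.factorial_mul_descFactorial (show a + 1 ≤ a + 1 + (b + 1) by lia)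
    rw [Nat.add_sub_cancel_left] at this
    rw [add_comm (b + 1) (a + 1)]
    exact_mod_cast this
  rw [hdf, Nat.add_sub_cancel, Nat.factorial_succ a, Nat.factorial_succ b]
  push_cast
  field_simp

/-- Integrates (s/t)M - a = (s/t - 1)M + (M - a), with |M| ≤ 8, against the beta weight. As d ≥ 1
gives s ≤ log(1+n), the bound is free of d. -/
theorem abs_expectedStable_mul_bose_sub_le {n d : ℕ} (hn : 1 ≤ n) (hd : 1 ≤ d) {κ s : ℝ}
    (hκ : κ = 10 / Real.log (1 + n)) (hs : s = Real.log ((d + n) / d)) :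
    |expectedStable n (n + d) * bose s - Real.exp (bose s - 1)| ≤
      300008 * (2 * √κ + 4 * κ) + 300000 * (27 / √n + Real.log (1 + n) ^ 2 / n) := by
  have hn0 : (0 : ℝ) < n := by exact_mod_cast hn
  have hd0 : (0 : ℝ) < d := by exact_mod_cast hd
  have hd1 : (1 : ℝ) ≤ d := by exact_mod_cast hd
  have hB := betaMoment_zero_pos n hd
  obtain ⟨iR, hR⟩ := integral_abs_log_div_sub_one_le hd hn hκ hs
  have i0 := integrableOn_pow_mul_betaWeight 0 n hd
  have iA : IntegrableOn (fun t => s / t * betaWeight d n t * meanCorrection n d t)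
      (Set.Ioi 0) := by
    refine ((integral_prod_manFactor hn hd).1.const_mul s).congr (Eventually.of_forall fun t => ?_)
    simp only
    ring
  have hs0 : 0 ≤ s := hs ▸ Real.log_nonneg (by rw [one_le_div hd0]; linarith)
  have hsn : s ≤ Real.log (1 + n) := by
    rw [hs]
    refine Real.log_le_log (by positivity) ?_
    rw [div_le_iff₀ hd0]
    nlinarith
  set L := 27 / √n + Real.log (1 + n) ^ 2 / n with hL
  set a := Real.exp (bose s - 1) with ha
  have bound : ∀ᵐ t ∂volume.restrict (Set.Ioi (0 : ℝ)),
      ‖s / t * betaWeight d n t * meanCorrection n d t - a * (t ^ 0 * betaWeight d n t)‖ ≤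
      300008 * (|s / t - 1| * betaWeight d n t) + 300000 * L * (t ^ 0 * betaWeight d n t) := by
    filter_upwards [ae_restrict_mem measurableSet_Ioi] with t ht
    have ht : 0 < t := ht
    have hw := betaWeight_nonneg d n ht.le
    have m1 := (abs_meanCorrection_le n hd ht).trans exp_two_le
    have m2 := abs_meanCorrection_sub_le hn hd ht hs
    have e : s / t * betaWeight d n t * meanCorrection n d t - a * (t ^ 0 * betaWeight d n t) =
        ((s / t - 1) * meanCorrection n d t + (meanCorrection n d t - a)) * betaWeight d n t := by
      ring
    rw [e, norm_mul, Real.norm_of_nonneg hw, Real.norm_eq_abs]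
    have k1 := abs_add_le ((s / t - 1) * meanCorrection n d t) (meanCorrection n d t - a)
    have k2 : |(s / t - 1) * meanCorrection n d t| ≤ 8 * |s / t - 1| := by
      rw [abs_mul, mul_comm]
      exact mul_le_mul_of_nonneg_right m1 (abs_nonneg _)
    have k3 : s ^ 2 / n ≤ Real.log (1 + n) ^ 2 / n := by gcongr
    have k4 : |(s / t - 1) * meanCorrection n d t + (meanCorrection n d t - a)| ≤
        300008 * |s / t - 1| + 300000 * L := by
      rw [hL]
      linarith
    refine (mul_le_mul_of_nonneg_right k4 hw).trans (le_of_eq (by ring))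
  have hmain := norm_integral_le_of_norm_le ((iR.const_mul 300008).add (i0.const_mul (300000 * L)))
    bound
  simp only [Pi.add_apply] at hmain
  rw [integral_sub iA (i0.const_mul a), integral_add (iR.const_mul _) (i0.const_mul _),
    integral_const_mul, integral_const_mul, integral_const_mul, ← betaMoment,
    Real.norm_eq_abs] at hmain
  have e : expectedStable n (n + d) * bose s - a = ((∫ t in Set.Ioi (0 : ℝ),
      s / t * betaWeight d n t * meanCorrection n d t) - a * betaMoment 0 d n) /
      betaMoment 0 d n := by
    rw [expectedStable_mul_bose hn hd hs]
    field_simp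
  rw [e, abs_div, abs_of_pos hB, div_le_iff₀ hB]
  linarith

/-! ### Passage to the limit and the three regimes. -/

open Asymptotics

theorem tendsto_error_bound :
    Tendsto (fun n : ℕ => 300008 * (2 * √(10 / Real.log (1 + n)) + 4 * (10 / Real.log (1 + n))) +
      300000 * (27 / √n + Real.log (1 + n) ^ 2 / n)) atTop (𝓝 0) := by
  have hn : Tendsto (fun n : ℕ => (n : ℝ)) atTop atTop := tendsto_natCast_atTop_atTop
  have h1n : Tendsto (fun n : ℕ => 1 + (n : ℝ)) atTop atTop := tendsto_atTop_add_const_left _ 1 hn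
  have hκ : Tendsto (fun n : ℕ => 10 / Real.log (1 + n)) atTop (𝓝 0) :=
    (Real.tendsto_log_atTop.comp h1n).const_div_atTop 10
  have hsq : Tendsto (fun n : ℕ => √(10 / Real.log (1 + n))) atTop (𝓝 0) := by
    have := (Real.continuous_sqrt.tendsto 0).comp hκ
    rwa [Real.sqrt_zero] at this
  have h27 : Tendsto (fun n : ℕ => 27 / √(n : ℝ)) atTop (𝓝 0) :=
    (Real.tendsto_sqrt_atTop.comp hn).const_div_atTop 27
  have hlog : Tendsto (fun n : ℕ => Real.log (1 + n) ^ 2 / n) atTop (𝓝 0) := by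
    have h := (Real.isLittleO_pow_log_id_atTop (n := 2)).tendsto_div_nhds_zero.comp h1n
    have h2 : Tendsto (fun n : ℕ => 1 + 1 / (n : ℝ)) atTop (𝓝 (1 + 0)) :=
      tendsto_const_nhds.add (hn.const_div_atTop 1)
    have h3 := h.mul h2
    rw [zero_mul] at h3
    refine h3.congr' ?_
    filter_upwards [eventually_ge_atTop 1] with n hn1
    have : (0 : ℝ) < n := by exact_mod_cast hn1
    simp only [Function.comp, id]
    field_simp
    ring
  have := ((hsq.const_mul 2).add (hκ.const_mul 4)).const_mul 300008 |>.add
    ((h27.add hlog).const_mul 300000)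
  simpa only [mul_zero, add_zero] using this

variable {ι : Type*} {l : Filter ι} {n₁ n₂ : ι → ℕ}

theorem bose_sParam {n N : ℕ} (hn : 1 ≤ n) (h : n < N) :
    0 < sParam n N ∧ Real.exp (sParam n N) - 1 = n / ((N : ℝ) - n) ∧
      bose (sParam n N) = sParam n N * ((N : ℝ) - n) / n := by
  have hn0 : (0 : ℝ) < n := by exact_mod_cast hn
  have hd0 : (0 : ℝ) < (N : ℝ) - n := by rw [sub_pos]; exact_mod_cast h
  have hN0 : (0 : ℝ) < N := by linarith
  have e : Real.exp (sParam n N) - 1 = n / ((N : ℝ) - n) := by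
    rw [sParam, Real.exp_log (by positivity)]
    field_simp
    ring
  refine ⟨Real.log_pos ?_, e, ?_⟩
  · rw [one_lt_div hd0]; linarith
  · rw [bose, e, div_div_eq_mul_div]

theorem tendsto_expectedStable_mul_bose_sub (hlt : ∀ᶠ k in l, n₁ k < n₂ k)
    (hn₁ : Tendsto n₁ l atTop) :
    Tendsto (fun k => expectedStable (n₁ k) (n₂ k) * bose (sParam (n₁ k) (n₂ k)) -
      Real.exp (bose (sParam (n₁ k) (n₂ k)) - 1)) l (𝓝 0) := by
  refine squeeze_zero_norm' ?_ (tendsto_error_bound.comp hn₁)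
  filter_upwards [hlt, hn₁.eventually_ge_atTop 1] with k hk hk1
  have h := abs_expectedStable_mul_bose_sub_le hk1 (Nat.sub_pos_of_lt hk) rfl rfl
  rw [Nat.add_sub_cancel' hk.le, Nat.cast_sub hk.le, sub_add_cancel] at h
  exact h

theorem isEquivalent_expectedStable (hlt : ∀ᶠ k in l, n₁ k < n₂ k) (hn₁ : Tendsto n₁ l atTop) :
    IsEquivalent l (fun k => expectedStable (n₁ k) (n₂ k))
      fun k => Real.exp (bose (sParam (n₁ k) (n₂ k)) - 1) / bose (sParam (n₁ k) (n₂ k)) := by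
  have hpos : ∀ᶠ k in l, 0 < bose (sParam (n₁ k) (n₂ k)) := by
    filter_upwards [hlt, hn₁.eventually_ge_atTop 1] with k hk hk1
    have hs := (bose_sParam hk1 hk).1
    exact div_pos hs (exp_sub_one_pos hs)
  rw [isEquivalent_iff_tendsto_one (hpos.mono fun k hk => (div_pos (Real.exp_pos _) hk).ne')]
  have h0 := tendsto_expectedStable_mul_bose_sub hlt hn₁
  -- The additive error becomes a relative one because e^{g-1} is bounded below by e⁻¹.
  have h1 : Tendsto (fun k => (expectedStable (n₁ k) (n₂ k) * bose (sParam (n₁ k) (n₂ k)) -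
      Real.exp (bose (sParam (n₁ k) (n₂ k)) - 1)) *
      Real.exp (1 - bose (sParam (n₁ k) (n₂ k)))) l (𝓝 0) := by
    refine h0.zero_mul_isBoundedUnder_le (isBoundedUnder_of_eventually_le (a := Real.exp 1) ?_)
    filter_upwards [hpos] with k hk
    simp only [Function.comp, Real.norm_eq_abs, Real.abs_exp]
    gcongr
    linarith
  have h2 := h1.add_const 1
  rw [zero_add] at h2
  refine h2.congr' ?_
  filter_upwards [hpos] with k hk
  have e : Real.exp (1 - bose (sParam (n₁ k) (n₂ k))) =
      (Real.exp (bose (sParam (n₁ k) (n₂ k)) - 1))⁻¹ := by rw [← Real.exp_neg]; ring_nf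
  have := Real.exp_pos (bose (sParam (n₁ k) (n₂ k)) - 1)
  simp only [Pi.div_apply]
  rw [e]
  field_simp
  ring

theorem div_mul_sParam_eq {n N : ℕ} (hn : 1 ≤ n) (h : n < N) :
    (n : ℝ) / (((N : ℝ) - n) * sParam n N) = 1 / bose (sParam n N) := by
  obtain ⟨h0, -, h2⟩ := bose_sParam hn h
  have hn0 : (0 : ℝ) < n := by exact_mod_cast hn
  have hd0 : (0 : ℝ) < (N : ℝ) - n := by rw [sub_pos]; exact_mod_cast h
  rw [h2]
  field_simp

theorem mul_exp_div_eq {n N : ℕ} (hn : 1 ≤ n) (h : n < N) :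
    (n : ℝ) * Real.exp (-((Real.exp (sParam n N) - 1 - sParam n N) / (Real.exp (sParam n N) - 1)))
      / (((N : ℝ) - n) * sParam n N) =
    Real.exp (bose (sParam n N) - 1) / bose (sParam n N) := by
  have hs := (bose_sParam hn h).1
  have e : -((Real.exp (sParam n N) - 1 - sParam n N) / (Real.exp (sParam n N) - 1)) =
      bose (sParam n N) - 1 := by
    have := (exp_sub_one_pos hs).ne'
    rw [bose]
    field_simp
    ring
  rw [e, mul_div_right_comm, div_mul_sParam_eq hn h]
  ring

theorem tendsto_sParam_atTop (hlt : ∀ᶠ k in l, n₁ k < n₂ k) (hn₁ : Tendsto n₁ l atTop)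
    (h : Tendsto (fun k => (n₂ k : ℝ) / (n₁ k : ℝ)) l (𝓝 1)) :
    Tendsto (fun k => sParam (n₁ k) (n₂ k)) l atTop := by
  refine Real.tendsto_log_atTop.comp ?_
  have h1 : Tendsto (fun k => 1 - ((n₂ k : ℝ) / (n₁ k : ℝ))⁻¹) l (𝓝[>] 0) := by
    refine tendsto_nhdsWithin_iff.2 ⟨?_, ?_⟩
    · simpa using (h.inv₀ one_ne_zero).const_sub 1
    · filter_upwards [hlt, hn₁.eventually_ge_atTop 1] with k hk hk1
      have hn0 : (0 : ℝ) < n₁ k := by exact_mod_cast hk1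
      have hk' : (n₁ k : ℝ) < n₂ k := by exact_mod_cast hk
      rw [Set.mem_Ioi, inv_div, sub_pos, div_lt_one (by linarith)]
      exact hk'
  refine (tendsto_inv_nhdsGT_zero.comp h1).congr' ?_
  filter_upwards [hlt, hn₁.eventually_ge_atTop 1] with k hk hk1
  have hn0 : (0 : ℝ) < n₁ k := by exact_mod_cast hk1
  have hk' : (n₁ k : ℝ) < n₂ k := by exact_mod_cast hk
  have hd0 : (0 : ℝ) < (n₂ k : ℝ) - n₁ k := by linarith
  have hN0 : (0 : ℝ) < n₂ k := by linarith
  simp only [Function.comp]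
  rw [inv_div, one_sub_div hN0.ne', inv_div]

theorem tendsto_bose_of_tendsto_atTop {s : ι → ℝ} (h : Tendsto s l atTop) :
    Tendsto (fun k => bose (s k)) l (𝓝 0) := by
  refine squeeze_zero' ?_ ?_ (h.const_div_atTop 1)
  · filter_upwards [h.eventually_gt_atTop 0] with k hk using bose_nonneg hk
  · filter_upwards [h.eventually_gt_atTop 0] with k hk
    rw [le_div_iff₀ hk, mul_comm]
    exact mul_bose_le_one hk

theorem tendsto_expectedStable_of_tendsto_bose (hlt : ∀ᶠ k in l, n₁ k < n₂ k)
    (hn₁ : Tendsto n₁ l atTop) {b : ℝ} (hb : b ≠ 0)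
    (h : Tendsto (fun k => bose (sParam (n₁ k) (n₂ k))) l (𝓝 b)) :
    Tendsto (fun k => expectedStable (n₁ k) (n₂ k)) l (𝓝 (Real.exp (b - 1) / b)) :=
  (isEquivalent_expectedStable hlt hn₁).symm.tendsto_nhds
    (((Real.continuous_exp.tendsto _).comp (h.sub_const 1)).div h hb)

/-- With x = n₂/n₁ the right side is log λ(x), so regimes (ii) and (iii) are limits in x. -/
theorem bose_sParam_eq_ratio {n N : ℕ} (hn : 1 ≤ n) (h : n < N) :
    bose (sParam n N) =
      Real.log ((N : ℝ) / n / ((N : ℝ) / n - 1)) * ((N : ℝ) / n - 1) := by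
  obtain ⟨-, -, h2⟩ := bose_sParam hn h
  have hn0 : (0 : ℝ) < n := by exact_mod_cast hn
  have hd0 : (0 : ℝ) < (N : ℝ) - n := by rw [sub_pos]; exact_mod_cast h
  have e1 : (N : ℝ) / n - 1 = (N - n) / n := by field_simp
  have e2 : (N : ℝ) / n / ((N - n) / n) = N / (N - n) := by field_simp
  rw [h2, e1, e2, sParam, mul_div_assoc]

end StableMatching

theorem theorem2 {ι : Type*} (l : Filter ι) (n₁ n₂ : ι → ℕ)
    (hlt : ∀ᶠ k in l, n₁ k < n₂ k) (hn₁ : Tendsto n₁ l atTop) :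
    Asymptotics.IsEquivalent l
      (fun k => StableMatching.expectedStable (n₁ k) (n₂ k))
      (fun k =>
        (n₁ k : ℝ) *
            Real.exp (-((Real.exp (StableMatching.sParam (n₁ k) (n₂ k)) - 1
                  - StableMatching.sParam (n₁ k) (n₂ k))
                / (Real.exp (StableMatching.sParam (n₁ k) (n₂ k)) - 1)))
          / (((n₂ k : ℝ) - (n₁ k : ℝ)) * StableMatching.sParam (n₁ k) (n₂ k))) ∧
    (Tendsto (fun k => (n₂ k : ℝ) / (n₁ k : ℝ)) l (𝓝 1) →
      Tendsto (fun k => StableMatching.sParam (n₁ k) (n₂ k)) l atTop ∧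
      Asymptotics.IsEquivalent l
        (fun k => StableMatching.expectedStable (n₁ k) (n₂ k))
        (fun k => Real.exp (-1) *
          ((n₁ k : ℝ) / (((n₂ k : ℝ) - (n₁ k : ℝ)) * StableMatching.sParam (n₁ k) (n₂ k)))) ∧
      (Tendsto (fun k => Real.log ((n₂ k : ℝ) - (n₁ k : ℝ)) / Real.log (n₁ k : ℝ)) l (𝓝 0) →
        Asymptotics.IsEquivalent l
          (fun k => StableMatching.expectedStable (n₁ k) (n₂ k))
          (fun k => Real.exp (-1) *
            ((n₁ k : ℝ) / (((n₂ k : ℝ) - (n₁ k : ℝ)) * Real.log (n₁ k : ℝ)))))) ∧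
    (Tendsto (fun k => (n₂ k : ℝ) / (n₁ k : ℝ)) l atTop →
      Tendsto (fun k => StableMatching.expectedStable (n₁ k) (n₂ k)) l (𝓝 1)) ∧
    (∀ c : ℝ, 1 < c →
      Tendsto (fun k => (n₂ k : ℝ) / (n₁ k : ℝ)) l (𝓝 c) →
      Tendsto (fun k => StableMatching.expectedStable (n₁ k) (n₂ k)) l
        (𝓝 (Real.exp (-1) * (StableMatching.lam c / Real.log (StableMatching.lam c))))) := by
  open StableMatching Asymptotics in
  have hone := hn₁.eventually_ge_atTop 1
  have hmain := isEquivalent_expectedStable hlt hn₁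
  refine ⟨hmain.congr_right ?_, fun h => ?_, fun h => ?_, fun c hc h => ?_⟩
  · filter_upwards [hlt, hone] with k hk hk1 using (mul_exp_div_eq hk1 hk).symm
  · have hs := tendsto_sParam_atTop hlt hn₁ h
    have hexp : IsEquivalent l (fun k => Real.exp (bose (sParam (n₁ k) (n₂ k)) - 1))
        fun _ => Real.exp (-1) := by
      refine (isEquivalent_const_iff_tendsto (Real.exp_pos _).ne').2 ?_
      refine (Real.continuous_exp.tendsto _).comp ?_
      simpa using (tendsto_bose_of_tendsto_atTop hs).sub_const 1
    have hE : IsEquivalent l (fun k => expectedStable (n₁ k) (n₂ k)) fun k => Real.exp (-1) *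
        ((n₁ k : ℝ) / (((n₂ k : ℝ) - (n₁ k : ℝ)) * sParam (n₁ k) (n₂ k))) := by
      refine hmain.trans ((hexp.div (IsEquivalent.refl
        (u := fun k => bose (sParam (n₁ k) (n₂ k))))).congr_right ?_)
      filter_upwards [hlt, hone] with k hk hk1
      rw [div_mul_sParam_eq hk1 hk, Pi.div_apply]
      ring
    refine ⟨hs, hE, fun hlog => ?_⟩
    -- s/log n₁ = 1 + log(n₂/n₁)/log n₁ - log(n₂-n₁)/log n₁.
    have hratio : Tendsto (fun k => sParam (n₁ k) (n₂ k) / Real.log (n₁ k : ℝ)) l (𝓝 1) := by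
      have hl : Tendsto (fun k => Real.log (n₁ k : ℝ)) l atTop :=
        Real.tendsto_log_atTop.comp (tendsto_natCast_atTop_atTop.comp hn₁)
      have h1 : Tendsto (fun k => Real.log ((n₂ k : ℝ) / (n₁ k : ℝ)) / Real.log (n₁ k : ℝ)) l
          (𝓝 0) := (h.log one_ne_zero).div_atTop hl
      have h2 := (h1.sub hlog).const_add 1
      rw [sub_zero, add_zero] at h2
      refine h2.congr' ?_
      filter_upwards [hlt, hone, hl.eventually_gt_atTop 0] with k hk hk1 hk2
      have hn0 : (0 : ℝ) < n₁ k := by exact_mod_cast hk1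
      have hk' : (n₁ k : ℝ) < n₂ k := by exact_mod_cast hk
      have hd0 : (n₂ k : ℝ) - n₁ k ≠ 0 := by linarith
      have hN0 : (n₂ k : ℝ) ≠ 0 := by linarith
      rw [sParam, Real.log_div hN0 hd0, Real.log_div hN0 hn0.ne']
      field_simp
      ring
    have hsl : IsEquivalent l (fun k => sParam (n₁ k) (n₂ k)) fun k => Real.log (n₁ k : ℝ) := by
      refine (isEquivalent_iff_tendsto_one ?_).2 hratio
      filter_upwards [hn₁.eventually_ge_atTop 2] with k hk
      exact (Real.log_pos (by exact_mod_cast hk)).ne'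
    exact hE.trans (IsEquivalent.refl.mul (IsEquivalent.refl.div (IsEquivalent.refl.mul hsl)))
  · have hb : Tendsto (fun k => bose (sParam (n₁ k) (n₂ k))) l (𝓝 1) := by
      -- Squeeze: log(x/(x-1)) ≥ 1/x gives the lower bound 1 - 1/x, and the upper bound is 1.
      have hlow : Tendsto (fun k => 1 - 1 / ((n₂ k : ℝ) / (n₁ k : ℝ))) l (𝓝 1) := by
        simpa using (h.const_div_atTop 1).const_sub 1
      refine tendsto_of_tendsto_of_tendsto_of_le_of_le' hlow tendsto_const_nhds ?_ ?_
      · filter_upwards [hlt, hone, h.eventually_gt_atTop 1] with k hk hk1 hx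
        rw [bose_sParam_eq_ratio hk1 hk]
        set x := (n₂ k : ℝ) / (n₁ k : ℝ)
        have hx1 : 0 < x - 1 := by linarith
        have hx0 : 0 < x := by linarith
        have := Real.one_sub_inv_le_log_of_pos (div_pos hx0 hx1)
        calc 1 - 1 / x = (1 - (x / (x - 1))⁻¹) * (x - 1) := by field_simp; ring
          _ ≤ _ := by gcongr
      · filter_upwards [hlt, hone] with k hk hk1 using bose_le_one (bose_sParam hk1 hk).1
    simpa using tendsto_expectedStable_of_tendsto_bose hlt hn₁ one_ne_zero hb
  · have hc1 : 0 < c - 1 := by linarith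
    have hcp : 0 < c / (c - 1) := div_pos (by linarith) hc1
    have hlam : Real.log (lam c) = Real.log (c / (c - 1)) * (c - 1) := by
      rw [lam, Real.log_rpow hcp, mul_comm]
    have hlampos : 0 < Real.log (lam c) := by
      rw [hlam]
      exact mul_pos (Real.log_pos (by rw [one_lt_div hc1]; linarith)) hc1
    have hb : Tendsto (fun k => bose (sParam (n₁ k) (n₂ k))) l (𝓝 (Real.log (lam c))) := by
      rw [hlam]
      refine Tendsto.congr' ?_ (((h.div (h.sub_const 1) hc1.ne').log hcp.ne').mul (h.sub_const 1))
      filter_upwards [hlt, hone] with k hk hk1 using (bose_sParam_eq_ratio hk1 hk).symm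
    have := tendsto_expectedStable_of_tendsto_bose hlt hn₁ hlampos.ne' hb
    have e : Real.exp (Real.log (lam c) - 1) / Real.log (lam c) =
        Real.exp (-1) * (lam c / Real.log (lam c)) := by
      rw [sub_eq_add_neg, Real.exp_add, Real.exp_log (show 0 < lam c from Real.rpow_pos_of_pos hcp _)]
      ring
    rwa [e] at this
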